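/- Let $k$ be a field. An algebraic group over $k$ is a group scheme of finite type over $k$. For an algebraic group $G$ over $k$ and a $k$-scheme $X$, a *$G$-torsor* over $X$ is a morphism of $k$-schemes $p\colon T\to X$ together with a (left) action of $G$ on $T$ over $X$ such that $G\times_k T\to T\times_X T$, $(g,x)\mapsto (x,g\cdot x)$, is an isomorphism, and such that there exist a faithfully flat morphism $X'\to X$ of $k$-schemes, locally of finite presentation, and a $G$-equivariant isomorphism $T\times_X X'\cong G\times_k X'$ over $X'$. The torsor is *split* if it is isomorphic, $G$-equivariantly over $X$, to $G\times_k X\to X$ with $G$ acting by left translations. We say that $G$ *has trivial torsors over semi-local rings* if, for every commutative ring $S$ containing $k$ (i.e. every nonzero commutative $k$-algebra) that has only finitely many maximal ideals, every $G$-torsor over $\operatorname{Spec}(S)$ is split. A smooth connected algebraic group $U$ over $k$ is called *$k$-split unipotent* if there is a tower $1=U_0\hookrightarrow U_1\hookrightarrow\dots\hookrightarrow U_r=U$ of algebraic groups over $k$ ($r\ge 0$) such that each $U_i$ is normal in $U_{i+1}$ and the quotient $U_{i+1}/U_i$ is isomorphic to $\mathbb{G}_a$ over $k$. **Lemma.**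 The following algebraic groups over $k$ have trivial torsors over semi-local rings, for every integer $n\ge 1$: (a) the general linear group $\operatorname{GL}_n$; (b) the special linear group $\operatorname{SL}_n$; (c) the symplectic group $\operatorname{Sp}_{2n}$; (d) every $k$-split smooth connected unipotent group. -/

import Mathlib

open CategoryTheory MonoidalCategory CartesianMonoidalCategory AlgebraicGeometry Opposite

universe u

noncomputable section

namespace SpecialGroups

/-! ### Group schemes given by a representable group functor -/

section Representable

variable (k : Type u) [Field k]

/-- The category of `k`-schemes. -/
abbrev Sch : Type (u + 1) := Over (Spec (CommRingCat.of k))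

/-- A group functor `F` on `k`-algebras gives the group functor `X ↦ F(Γ(X, 𝒪_X))` on
`k`-schemes. -/
abbrev schFunctor (F : CommAlgCat.{u} k ⥤ GrpCat.{u}) : (Sch k)ᵒᵖ ⥤ GrpCat.{u} :=
  (algΓ (CommRingCat.of k)).leftOp ⋙ F

/-- If the `k`-algebra `A` represents the group functor `F` on `k`-algebras, then the `k`-scheme
`Spec A` represents `X ↦ F(Γ(X, 𝒪_X))` on all `k`-schemes. -/
def specRepresentableBy (F : CommAlgCat.{u} k ⥤ GrpCat.{u}) (A : CommAlgCat.{u} k)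
    (e : (F ⋙ forget GrpCat).CorepresentableBy A) :
    (schFunctor k F ⋙ forget GrpCat).RepresentableBy
      ((algSpec (CommRingCat.of k)).obj (op A)) where
  homEquiv {X} :=
    (((algΓAlgSpecAdjunction (CommRingCat.of k)).homEquiv X (op A)).symm.trans
      (opEquiv _ _)).trans e.homEquiv
  homEquiv_comp {X X'} f g := by
    have h := (algΓAlgSpecAdjunction (CommRingCat.of k)).homEquiv_naturality_left_symm f g
    simp only [Equiv.trans_apply, h]
    exact e.homEquiv_comp _ _

/-- The affine group scheme over `k` with coordinate ring `A` representing the group functor `F`: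
the `k`-scheme `Spec A`, with the group structure induced by that of `F` (Yoneda). -/
def affineGroup (F : CommAlgCat.{u} k ⥤ GrpCat.{u}) (A : CommAlgCat.{u} k)
    (e : (F ⋙ forget GrpCat).CorepresentableBy A) : Grp (Sch k) :=
  letI : GrpObj ((algSpec (CommRingCat.of k)).obj (op A)) :=
    GrpObj.ofRepresentableBy _ (schFunctor k F) (specRepresentableBy k F A e)
  ⟨(algSpec (CommRingCat.of k)).obj (op A)⟩

end Representable

/-! ### The groups `GL_n`, `SL_n`, `Sp_{2n}` and `𝔾_a` -/

section Groups

variable (k : Type u) [Field k] (n : ℕ)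

/-- The group functor `R ↦ GL_n(R)`. -/
def glFunctor : CommAlgCat.{u} k ⥤ GrpCat.{u} where
  obj R := GrpCat.of (GL (Fin n) R)
  map f := GrpCat.ofHom (Matrix.GeneralLinearGroup.map f.hom.toRingHom)

/-- The coordinate ring `k[x_{ij}][1/det]` of `GL_n`. -/
abbrev glRing : Type u :=
  Localization.Away (Matrix.mvPolynomialX (Fin n) (Fin n) k).det

/-- The generic invertible matrix `(x_{ij})`. -/
def glGeneric : GL (Fin n) (glRing k n) :=
  Matrix.GeneralLinearGroup.mk''
    ((Algebra.algHom k (MvPolynomial (Fin n × Fin n) k) (glRing k n)).mapMatrix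
      (Matrix.mvPolynomialX (Fin n) (Fin n) k)) (by
    rw [← AlgHom.map_det]
    exact IsLocalization.Away.algebraMap_isUnit _)

theorem isUnit_aeval_det {R : Type u} [CommRing R] [Algebra k R] (M : GL (Fin n) R) :
    IsUnit (MvPolynomial.aeval (fun ij : Fin n × Fin n => M.1 ij.1 ij.2)
      (Matrix.mvPolynomialX (Fin n) (Fin n) k).det) := by
  rw [AlgHom.map_det, Matrix.mvPolynomialX_mapMatrix_aeval]
  exact (Matrix.isUnit_iff_isUnit_det _).1 M.isUnit

/-- The homomorphism `k[x_{ij}][1/det] → R` given by an invertible matrix. -/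
def glLift {R : Type u} [CommRing R] [Algebra k R] (M : GL (Fin n) R) : glRing k n →ₐ[k] R :=
  IsLocalization.Away.liftAlgHom (f := MvPolynomial.aeval fun ij : Fin n × Fin n => M.1 ij.1 ij.2)
    (Matrix.mvPolynomialX (Fin n) (Fin n) k).det (isUnit_aeval_det k n M)

theorem glLift_generic {R : Type u} [CommRing R] [Algebra k R] (M : GL (Fin n) R) (i j : Fin n) :
    glLift k n M ((glGeneric k n).1 i j) = M.1 i j := by
  refine (IsLocalization.Away.lift_eq (S := glRing k n)
    (Matrix.mvPolynomialX (Fin n) (Fin n) k).det (isUnit_aeval_det k n M)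
    (MvPolynomial.X (i, j))).trans ?_
  exact MvPolynomial.aeval_X _ _

/-- `GL_n(R)` is the set of `k`-algebra homomorphisms `k[x_{ij}][1/det] → R`. -/
def glCorepresentableBy :
    (glFunctor k n ⋙ forget GrpCat).CorepresentableBy (CommAlgCat.of k (glRing k n)) where
  homEquiv {R} :=
    { toFun f := Matrix.GeneralLinearGroup.map f.hom.toRingHom (glGeneric k n)
      invFun M := CommAlgCat.ofHom (glLift k n M)
      left_inv f := by
        ext1
        apply IsLocalization.algHom_ext
          (Submonoid.powers (Matrix.mvPolynomialX (Fin n) (Fin n) k).det)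
        ext ij
        exact glLift_generic k n _ ij.1 ij.2
      right_inv M := by
        apply Units.ext
        ext i j
        exact glLift_generic k n M i j }
  homEquiv_comp f g := rfl

/-- The general linear group `GL_n` over `k`. -/
def GLn : Grp (Sch k) := affineGroup k (glFunctor k n) _ (glCorepresentableBy k n)

/-- The group functor `R ↦ SL_n(R)`. -/
def slFunctor : CommAlgCat.{u} k ⥤ GrpCat.{u} where
  obj R := GrpCat.of (Matrix.SpecialLinearGroup (Fin n) R)
  map f := GrpCat.ofHom (Matrix.SpecialLinearGroup.map f.hom.toRingHom)

/-- The ideal generated by `det - 1`. -/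
def slIdeal : Ideal (MvPolynomial (Fin n × Fin n) k) :=
  Ideal.span {(Matrix.mvPolynomialX (Fin n) (Fin n) k).det - 1}

/-- The coordinate ring `k[x_{ij}]/(det - 1)` of `SL_n`. -/
abbrev slRing : Type u := MvPolynomial (Fin n × Fin n) k ⧸ slIdeal k n

/-- The generic matrix `(x_{ij})` of determinant `1`. -/
def slGeneric : Matrix.SpecialLinearGroup (Fin n) (slRing k n) :=
  ⟨(Ideal.Quotient.mkₐ k (slIdeal k n)).mapMatrix (Matrix.mvPolynomialX (Fin n) (Fin n) k), by
    rw [← AlgHom.map_det, ← sub_eq_zero, ← map_one (Ideal.Quotient.mkₐ k (slIdeal k n)), ← map_sub]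
    exact Ideal.Quotient.eq_zero_iff_mem.2 (Ideal.subset_span rfl)⟩

/-- The homomorphism `k[x_{ij}]/(det - 1) → R` given by a matrix of determinant `1`. -/
def slLift {R : Type u} [CommRing R] [Algebra k R] (M : Matrix.SpecialLinearGroup (Fin n) R) :
    slRing k n →ₐ[k] R :=
  Ideal.Quotient.liftₐ _ (MvPolynomial.aeval fun ij : Fin n × Fin n => M.1 ij.1 ij.2) (by
    change slIdeal k n ≤ RingHom.ker _
    rw [slIdeal, Ideal.span_singleton_le_iff_mem, RingHom.mem_ker, map_sub, map_one, AlgHom.map_det,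
      Matrix.mvPolynomialX_mapMatrix_aeval, M.2, sub_self])

theorem slLift_generic {R : Type u} [CommRing R] [Algebra k R]
    (M : Matrix.SpecialLinearGroup (Fin n) R) (i j : Fin n) :
    slLift k n M ((slGeneric k n).1 i j) = M.1 i j :=
  MvPolynomial.aeval_X (fun ij : Fin n × Fin n => M.1 ij.1 ij.2) (i, j)

/-- `SL_n(R)` is the set of `k`-algebra homomorphisms `k[x_{ij}]/(det - 1) → R`. -/
def slCorepresentableBy :
    (slFunctor k n ⋙ forget GrpCat).CorepresentableBy (CommAlgCat.of k (slRing k n)) where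
  homEquiv {R} :=
    { toFun f := Matrix.SpecialLinearGroup.map f.hom.toRingHom (slGeneric k n)
      invFun M := CommAlgCat.ofHom (slLift k n M)
      left_inv f := by
        ext1
        apply Ideal.Quotient.algHom_ext
        ext ij
        exact slLift_generic k n _ ij.1 ij.2
      right_inv M := by
        apply Subtype.ext
        ext i j
        exact slLift_generic k n M i j }
  homEquiv_comp f g := rfl

/-- The special linear group `SL_n` over `k`. -/
def SLn : Grp (Sch k) := affineGroup k (slFunctor k n) _ (slCorepresentableBy k n)

/-- The map induced by a ring homomorphism on symplectic groups. -/
def symplecticMap {R S : Type u} [CommRing R] [CommRing S] (f : R →+* S) :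
    Matrix.symplecticGroup (Fin n) R →* Matrix.symplecticGroup (Fin n) S where
  toFun A := ⟨A.1.map f, SymplecticGroup.map_mem A.2 f⟩
  map_one' := by ext1; simp
  map_mul' A B := by ext1; simp

/-- The group functor `R ↦ Sp_{2n}(R)` of invertible `2n × 2n` matrices preserving the standard
symplectic form. -/
def spFunctor : CommAlgCat.{u} k ⥤ GrpCat.{u} where
  obj R := GrpCat.of (Matrix.symplecticGroup (Fin n) R)
  map f := GrpCat.ofHom (symplecticMap n f.hom.toRingHom)

/-- The generic `2n × 2n` matrix `(x_{ij})`. -/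
abbrev spGeneric :
    Matrix (Fin n ⊕ Fin n) (Fin n ⊕ Fin n) (MvPolynomial ((Fin n ⊕ Fin n) × (Fin n ⊕ Fin n)) k) :=
  Matrix.mvPolynomialX (Fin n ⊕ Fin n) (Fin n ⊕ Fin n) k

/-- The matrix `X J Xᵀ - J`, where `X` is the generic `2n × 2n` matrix and `J` is the matrix of
the standard symplectic form. -/
abbrev spRelation :
    Matrix (Fin n ⊕ Fin n) (Fin n ⊕ Fin n) (MvPolynomial ((Fin n ⊕ Fin n) × (Fin n ⊕ Fin n)) k) :=
  spGeneric k n * Matrix.J (Fin n) _ * (spGeneric k n).transpose - Matrix.J (Fin n) _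

/-- The ideal generated by the entries of `X J Xᵀ - J`. -/
def spIdeal : Ideal (MvPolynomial ((Fin n ⊕ Fin n) × (Fin n ⊕ Fin n)) k) :=
  Ideal.span (Set.range fun ij : (Fin n ⊕ Fin n) × (Fin n ⊕ Fin n) => spRelation k n ij.1 ij.2)

/-- The coordinate ring `k[x_{ij}]/(X J Xᵀ - J)` of `Sp_{2n}`. -/
abbrev spRing : Type u :=
  MvPolynomial ((Fin n ⊕ Fin n) × (Fin n ⊕ Fin n)) k ⧸ spIdeal k n

theorem spRelation_map {R : Type u} [CommRing R] [Algebra k R]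
    (f : MvPolynomial ((Fin n ⊕ Fin n) × (Fin n ⊕ Fin n)) k →ₐ[k] R) :
    (spRelation k n).map f = (spGeneric k n).map f * Matrix.J (Fin n) R *
      ((spGeneric k n).map f).transpose - Matrix.J (Fin n) R := by
  rw [spRelation, Matrix.map_sub _ (map_sub f), Matrix.map_mul, Matrix.map_mul, Matrix.map_J,
    Matrix.transpose_map]

/-- The generic symplectic matrix. -/
def spGenericMem : Matrix.symplecticGroup (Fin n) (spRing k n) :=
  ⟨(spGeneric k n).map (Ideal.Quotient.mkₐ k (spIdeal k n)), by
    rw [SymplecticGroup.mem_iff, ← sub_eq_zero, ← spRelation_map]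
    ext i j
    exact Ideal.Quotient.eq_zero_iff_mem.2 (Ideal.subset_span ⟨(i, j), rfl⟩)⟩

/-- The homomorphism `k[x_{ij}]/(X J Xᵀ - J) → R` given by a symplectic matrix. -/
def spLift {R : Type u} [CommRing R] [Algebra k R] (M : Matrix.symplecticGroup (Fin n) R) :
    spRing k n →ₐ[k] R :=
  Ideal.Quotient.liftₐ _
    (MvPolynomial.aeval fun ij : (Fin n ⊕ Fin n) × (Fin n ⊕ Fin n) => M.1 ij.1 ij.2) (by
      change spIdeal k n ≤ RingHom.ker _
      rw [spIdeal, Ideal.span_le]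
      rintro _ ⟨⟨i, j⟩, rfl⟩
      have h := congrFun (congrFun (spRelation_map k n
        (MvPolynomial.aeval fun ij : (Fin n ⊕ Fin n) × (Fin n ⊕ Fin n) => M.1 ij.1 ij.2)) i) j
      have hM : (spGeneric k n).map (MvPolynomial.aeval fun ij => M.1 ij.1 ij.2) = M.1 := by
        ext i j
        exact MvPolynomial.aeval_X _ _
      rw [hM, SymplecticGroup.mem_iff.1 M.2, sub_self] at h
      exact h)

theorem spLift_generic {R : Type u} [CommRing R] [Algebra k R]
    (M : Matrix.symplecticGroup (Fin n) R) (i j : Fin n ⊕ Fin n) :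
    spLift k n M ((spGenericMem k n).1 i j) = M.1 i j :=
  MvPolynomial.aeval_X (fun ij : (Fin n ⊕ Fin n) × (Fin n ⊕ Fin n) => M.1 ij.1 ij.2) (i, j)

/-- `Sp_{2n}(R)` is the set of `k`-algebra homomorphisms `k[x_{ij}]/(X J Xᵀ - J) → R`. -/
def spCorepresentableBy :
    (spFunctor k n ⋙ forget GrpCat).CorepresentableBy (CommAlgCat.of k (spRing k n)) where
  homEquiv {R} :=
    { toFun f := symplecticMap n f.hom.toRingHom (spGenericMem k n)
      invFun M := CommAlgCat.ofHom (spLift k n M)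
      left_inv f := by
        ext1
        apply Ideal.Quotient.algHom_ext
        ext ij
        exact spLift_generic k n _ ij.1 ij.2
      right_inv M := by
        apply Subtype.ext
        ext i j
        exact spLift_generic k n M i j }
  homEquiv_comp f g := rfl

/-- The symplectic group `Sp_{2n}` over `k`. -/
def Sp2n : Grp (Sch k) := affineGroup k (spFunctor k n) _ (spCorepresentableBy k n)

/-- The group functor `R ↦ (R, +)`. -/
def gaFunctor : CommAlgCat.{u} k ⥤ GrpCat.{u} where
  obj R := GrpCat.of (Multiplicative R)
  map f := GrpCat.ofHom (AddMonoidHom.toMultiplicative f.hom.toRingHom.toAddMonoidHom)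

/-- `(R, +)` is the set of `k`-algebra homomorphisms `k[t] → R`. -/
def gaCorepresentableBy :
    (gaFunctor k ⋙ forget GrpCat).CorepresentableBy (CommAlgCat.of k (Polynomial k)) where
  homEquiv {R} :=
    { toFun f := Multiplicative.ofAdd (f.hom Polynomial.X)
      invFun a := CommAlgCat.ofHom (Polynomial.aeval (Multiplicative.toAdd a : R))
      left_inv f := by
        ext1
        exact Polynomial.algHom_ext (Polynomial.aeval_X _)
      right_inv a := Polynomial.aeval_X (Multiplicative.toAdd a : R) }
  homEquiv_comp f g := rfl

/-- The additive group `𝔾_a` over `k`. -/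
def Ga : Grp (Sch k) := affineGroup k (gaFunctor k) _ (gaCorepresentableBy k)

end Groups

/-! ### Torsors -/

section Torsors

variable {k : Type u} [Field k]

open MonObj

/-- The action of `G` on `G × Y` by left translation on the first factor. -/
@[reducible]
def translation (G Y : Sch k) [MonObj G] : ModObj G (G ⊗ Y) where
  smul := (α_ G G Y).inv ≫ μ[G] ▷ Y
  one_smul := by
    simp [← comp_whiskerRight]
  mul_smul := by
    simp only [selfLeftAction_actionHomLeft, selfLeftAction_actionAssocIso,
      selfLeftAction_actionHomRight]
    rw [associator_inv_naturality_left_assoc, ← comp_whiskerRight, MonObj.mul_assoc]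
    monoidal

/-- `X' → X` is an fppf covering: faithfully flat and locally of finite presentation. -/
structure IsFppfCover {X' X : Sch k} (f : X' ⟶ X) : Prop where
  flat : Flat f.left
  surjective : Surjective f.left
  locallyOfFinitePresentation : LocallyOfFinitePresentation f.left

/-- A `k`-scheme `T` with a left action of `G` and a morphism `p : T ⟶ X` of `k`-schemes is an
*fppf `G`-torsor* over `X`. -/
structure IsFppfTorsor (G : Sch k) [GrpObj G] {T X : Sch k} [ModObj G T] (p : T ⟶ X) : Prop where
  /-- The map `(g, x) ↦ (x, g • x)` is an isomorphism `G ×_k T ≅ T ×_X T`, where `G ×_k T` is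
  the same as `G_X ×_X T`; in particular, `p (g • x) = p x`, i.e. `G` acts over `X`. -/
  isPullback : IsPullback (snd G T) γ[G, T] p p
  /-- There is an fppf covering `f : X' ⟶ X` and a `G`-equivariant isomorphism of `X'`-schemes
  `G ×_k X' ≅ T ×_X X'`. It is given by its first component `h`: the square exhibits `G ×_k X'`,
  with the maps `h` to `T` and the projection to `X'`, as the fibre product of `T` and `X'`
  over `X`. -/
  locallyTrivial : ∃ (X' : Sch k) (f : X' ⟶ X) (h : G ⊗ X' ⟶ T),
    IsFppfCover f ∧ IsPullback h (snd G X') p f ∧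
      (letI := translation G X'; IsModHom G h)

/-- The `G`-torsor `p : T ⟶ X` is *split*: it is isomorphic to `G ×_k X → X`, with `G` acting by
left translations on the first factor. -/
def IsSplitTorsor (G : Sch k) [GrpObj G] {T X : Sch k} [ModObj G T] (p : T ⟶ X) : Prop :=
  ∃ e : G ⊗ X ≅ T, e.hom ≫ p = snd G X ∧ (letI := translation G X; IsModHom G e.hom)

/-- The spectrum of a `k`-algebra, as a `k`-scheme. -/
abbrev specOver (k : Type u) [Field k] (S : Type u) [CommRing S] [Algebra k S] : Sch k :=
  Over.mk (Spec.map (CommRingCat.ofHom (algebraMap k S)))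

/-- `Tors(S, G) = 1` for every semi-local ring `S` containing `k`: every fppf `G`-torsor over
`Spec S` is split. A ring is semi-local if it has finitely many maximal ideals (it need not be
Noetherian); a ring containing `k` is the same as a nonzero `k`-algebra. -/
def HasTrivialTorsorsOverSemilocal (G : Grp (Sch k)) : Prop :=
  ∀ (S : Type u) [CommRing S] [Nontrivial S] [Algebra k S] [Finite (MaximalSpectrum S)]
    (T : Sch k) [ModObj G.X T] (p : T ⟶ specOver k S),
    IsFppfTorsor G.X p → IsSplitTorsor G.X p

end Torsors

/-! ### Split unipotent groups -/

section Unipotent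

variable {k : Type u} [Field k]

open MonObj

/-- The homomorphism `i : N ⟶ U` of group schemes over `k` identifies `N` with the kernel of
the faithfully flat homomorphism `q : U ⟶ Q`; i.e. `1 → N → U → Q → 1` is exact. Equivalently,
`i` identifies `N` with a closed normal subgroup of `U`, and `q` induces an isomorphism
`U/N ≅ Q`. -/
structure IsShortExact {N U Q : Grp (Sch k)} (i : N ⟶ U) (q : U ⟶ Q) : Prop where
  isKernel : IsPullback i.hom.hom (toUnit N.X) q.hom.hom η[Q.X]
  flat : Flat q.hom.hom.left
  surjective : Surjective q.hom.hom.left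

/-- There is a tower `1 = U_0 ↪ U_1 ↪ … ↪ U_r = U` of group schemes over `k` such that each `U_i`
is normal in `U_{i+1}` and `U_{i+1}/U_i` is isomorphic to `𝔾_a` over `k` (here `r ≥ 0`). -/
inductive HasGaTower : Grp (Sch k) → Prop
  | trivial (U : Grp (Sch k)) (h : IsIso (toUnit U.X)) : HasGaTower U
  | step (N U : Grp (Sch k)) (i : N ⟶ U) (q : U ⟶ Ga k) (h : IsShortExact i q)
      (hN : HasGaTower N) : HasGaTower U

/-- `U` is a `k`-split smooth connected unipotent algebraic group over `k`. (By base change, a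
tower over `k` gives one over the algebraic closure, so that `U` is unipotent.) -/
structure IsSplitUnipotent (U : Grp (Sch k)) : Prop where
  locallyOfFiniteType : LocallyOfFiniteType U.X.hom
  quasiCompact : QuasiCompact U.X.hom
  smooth : Smooth U.X.hom
  connected : ConnectedSpace U.X.left
  tower : HasGaTower U

end Unipotent

end SpecialGroups

end

/-! A torsor over `Spec S` acquires a point `t` over some faithfully flat `S`-algebra `S'`.
Comparing the pullbacks of `t` along two maps `f, g : S' → A` of `S`-algebras gives `c(f, g)` in
`G(A)` with `c(f, g) • f(t) = g(t)`, a cocycle. If `c(f, g) = g(b) f(b)⁻¹`, then `b⁻¹ • t` has equal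
pullbacks along all such pairs, descends to a section over `S`, and the torsor is split. So the
theorem is that cocycles are coboundaries, possibly after enlarging `S'`.

For `GL` this is descent of modules: the vectors of `S'^ι` invariant under `c` form an `S`-module
`M` with `S' ⊗ M ≅ S'^ι` (`invariantsEquiv`). It is finite flat of constant rank, hence free because
`S` is semi-local, and the matrix of a basis is the required `b`.

The other matrix groups start from a `GL`-trivialization `h`. For `SL` its determinant descends to
`S` and can be divided out. For `Sp` the standard form transported by `h` descends to a perfect
alternating form over `S`, which has a symplectic basis. For the additive group, embedded in `GL_2`,
the invariants form an extension of `S` by `S`, and an invariant vector with last coordinate `1`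
trivializes the cocycle; semi-locality plays no role here.

For a split unipotent `U` one climbs the tower. The image of `c` in the additive group is a
coboundary of some `a`. A lift of `a` to `U` exists only after a further faithfully flat extension,
which is why `TrivialCocycles` allows refinement. Twisting by that lift moves `c` into the smaller
group, where induction applies. -/

noncomputable section

namespace SpecialGroups

open scoped TensorProduct

/-! ### Descent data for group functors on algebras -/

section AlgCocycle

variable {k : Type u} [Field k]

/-- A `1`-cocycle of the extension `S → S'` of `k`-algebras with values in a group functor `F`:
a function associating with two homomorphisms of `S`-algebras `f g : S' → A` an element of `F(A)`,
naturally in `A` and such that `c(g, h) c(f, g) = c(f, h)`. -/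
structure AlgCocycle (F : CommAlgCat.{u} k ⥤ GrpCat.{u}) (S S' : Type u) [CommRing S] [CommRing S']
    [Algebra k S] [Algebra S S'] where
  /-- The value of the cocycle at two homomorphisms. -/
  toFun : ∀ {A : Type u} [CommRing A] [Algebra k A] [Algebra S A] [IsScalarTower k S A],
    (S' →ₐ[S] A) → (S' →ₐ[S] A) → F.obj (CommAlgCat.of k A)
  map_toFun : ∀ {A B : Type u} [CommRing A] [Algebra k A] [Algebra S A] [IsScalarTower k S A]
    [CommRing B] [Algebra k B] [Algebra S B] [IsScalarTower k S B] (φ : A →ₐ[S] B)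
    (f g : S' →ₐ[S] A),
    F.map (CommAlgCat.ofHom (φ.restrictScalars k)) (toFun f g) = toFun (φ.comp f) (φ.comp g)
  mul_toFun : ∀ {A : Type u} [CommRing A] [Algebra k A] [Algebra S A] [IsScalarTower k S A]
    (f g h : S' →ₐ[S] A), toFun g h * toFun f g = toFun f h

namespace AlgCocycle

variable {F F' : CommAlgCat.{u} k ⥤ GrpCat.{u}} {S S' : Type u} [CommRing S] [CommRing S']
  [Algebra k S] [Algebra S S']

/-- The image of a cocycle under a homomorphism of group functors. -/
def map (c : AlgCocycle F S S') (α : F ⟶ F') : AlgCocycle F' S S' where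
  toFun f g := α.app _ (c.toFun f g)
  map_toFun φ f g := by
    rw [← c.map_toFun φ f g]
    exact (NatTrans.naturality_apply α _ _).symm
  mul_toFun f g h := by
    rw [← c.mul_toFun f g h, map_mul]

/-- A cocycle is a coboundary if it is of the form `(f, g) ↦ g(b) f(b)⁻¹`. -/
def IsCoboundary [Algebra k S'] [IsScalarTower k S S'] (c : AlgCocycle F S S') : Prop :=
  ∃ b : F.obj (CommAlgCat.of k S'),
    ∀ {A : Type u} [CommRing A] [Algebra k A] [Algebra S A] [IsScalarTower k S A]
      (f g : S' →ₐ[S] A), c.toFun f g = F.map (CommAlgCat.ofHom (g.restrictScalars k)) b *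
        (F.map (CommAlgCat.ofHom (f.restrictScalars k)) b)⁻¹

end AlgCocycle

end AlgCocycle

/-! ### Faithfully flat descent for free modules -/

section Descent

variable {k : Type u} [Field k]

variable (k) in
/-- The group functor `R ↦ GL_ι(R)`. -/
def glFunctorOf (ι : Type) [Fintype ι] [DecidableEq ι] : CommAlgCat.{u} k ⥤ GrpCat.{u} where
  obj R := GrpCat.of (GL ι R)
  map f := GrpCat.ofHom (Matrix.GeneralLinearGroup.map f.hom.toRingHom)

variable {S S' : Type u} [CommRing S] [CommRing S'] [Algebra k S] [Algebra k S'] [Algebra S S']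
  [IsScalarTower k S S'] {ι : Type} [Fintype ι] [DecidableEq ι]

/-- The linear map `S' ⊗ S'^ι → A^ι` sending `a ⊗ x` to `f(a) g(x)`. -/
def tensorEval {A : Type u} [CommRing A] [Algebra S A] (f g : S' →ₐ[S] A) :
    S' ⊗[S] (ι → S') →ₗ[S] (ι → A) :=
  TensorProduct.lift (LinearMap.mk₂ S (fun a x i => f a * g (x i))
    (fun a b x => by ext; simp [add_mul]) (fun s a x => by ext; simp)
    (fun a x y => by ext; simp [mul_add]) (fun s a x => by ext; simp))

omit [Fintype ι] [DecidableEq ι] in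
@[simp]
theorem tensorEval_tmul {A : Type u} [CommRing A] [Algebra S A] (f g : S' →ₐ[S] A)
    (a : S') (x : ι → S') : tensorEval f g (a ⊗ₜ x) = fun i => f a * g (x i) := rfl

omit [Fintype ι] [DecidableEq ι] in
theorem tensorEval_comp {A B : Type u} [CommRing A] [Algebra S A] [CommRing B] [Algebra S B]
    (φ : A →ₐ[S] B) (f g : S' →ₐ[S] A) (y : S' ⊗[S] (ι → S')) :
    tensorEval (φ.comp f) (φ.comp g) y = φ ∘ tensorEval f g y := by
  induction y with
  | zero => ext; simp
  | tmul a x => ext; simp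
  | add y z hy hz => ext; simp [hy, hz]

variable (S S') in
/-- The homomorphism `a ↦ a ⊗ 1`. -/
def inl : S' →ₐ[S] S' ⊗[S] S' := Algebra.TensorProduct.includeLeft

variable (S S') in
/-- The homomorphism `a ↦ 1 ⊗ a`. -/
def inr : S' →ₐ[S] S' ⊗[S] S' := Algebra.TensorProduct.includeRight

-- This is the identification of `S' ⊗ S'^ι` with `(S' ⊗ S')^ι`, valid since `ι` is finite. It lets
-- an element of the former be described by its values under all pairs of maps.
variable (S S' ι) in
theorem tensorEval_bijective : Function.Bijective (tensorEval (ι := ι) (inl S S') (inr S S')) := by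
  have : tensorEval (ι := ι) (inl S S') (inr S S') =
      (TensorProduct.piRight S S S' (fun _ : ι => S')).toLinearMap := by
    ext; simp [inl, inr]
  rw [this]
  exact (TensorProduct.piRight S S S' (fun _ : ι => S')).bijective

/-- The invariants of `S'^ι` under the descent datum given by a cocycle with values in `GL_ι`. -/
def invariants (c : AlgCocycle (glFunctorOf k ι) S S') : Submodule S (ι → S') where
  carrier := {x | ∀ (A : Type u) [CommRing A] [Algebra k A] [Algebra S A] [IsScalarTower k S A]
    (f g : S' →ₐ[S] A), g ∘ x = (c.toFun f g : GL ι A).1.mulVec (f ∘ x)}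
  add_mem' {x y} hx hy A _ _ _ _ f g := by
    have h := congrArg₂ (· + ·) (hx A f g) (hy A f g)
    simp only [← Matrix.mulVec_add] at h
    convert h using 1
    · ext; simp
    · congr 1; ext; simp
  zero_mem' A _ _ _ _ f g := by
    have (φ : S' →ₐ[S] A) : φ ∘ (0 : ι → S') = 0 := by ext; simp
    rw [this, this, Matrix.mulVec_zero]
  smul_mem' s x hx A _ _ _ _ f g := by
    have (φ : S' →ₐ[S] A) : φ ∘ (s • x) = s • (φ ∘ x) := by ext; simp
    rw [this, this, hx A f g]
    exact (Matrix.mulVec_smul (c.toFun f g : GL ι A).1 s (f ∘ x)).symm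

/-- Every pair `f, g : S' → A` factors through the universal pair into `S' ⊗ S'`, so one equation
suffices. This presents the invariants as the kernel of a single linear map, to which flatness can
be applied. -/
theorem mem_invariants_iff (c : AlgCocycle (glFunctorOf k ι) S S') (x : ι → S') :
    x ∈ invariants c ↔ inr S S' ∘ x =
      (c.toFun (inl S S') (inr S S') : GL ι (S' ⊗[S] S')).1.mulVec (inl S S' ∘ x) := by
  refine ⟨fun h => h (S' ⊗[S] S') (inl S S') (inr S S'), fun h A _ _ _ _ f g => ?_⟩
  let φ : S' ⊗[S] S' →ₐ[S] A := Algebra.TensorProduct.lift f g fun _ _ => Commute.all _ _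
  have hf : φ.comp (inl S S') = f := by ext; simp [φ, inl]
  have hg : φ.comp (inr S S') = g := by ext; simp [φ, inr]
  have hc := c.map_toFun φ (inl S S') (inr S S')
  rw [hf, hg] at hc
  have h' := congrArg (fun z => φ ∘ z) h
  rw [← hc, ← hf, ← hg]
  refine Eq.trans h' ?_
  ext i
  exact RingHom.map_mulVec φ.toRingHom _ _ i

end Descent

/-! ### Effectivity of the descent datum: invariants after base change -/

section InvariantsBaseChange

variable {k : Type u} [Field k] {S S' : Type u} [CommRing S] [CommRing S'] [Algebra k S]
  [Algebra S S'] {ι : Type} [Fintype ι] [DecidableEq ι]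

/-- The value of a cocycle with values in `GL_ι`, as a matrix. -/
def AlgCocycle.matrix (c : AlgCocycle (glFunctorOf k ι) S S') {A : Type u} [CommRing A]
    [Algebra k A] [Algebra S A] [IsScalarTower k S A] (f g : S' →ₐ[S] A) : Matrix ι ι A :=
  (c.toFun f g : GL ι A).1

theorem AlgCocycle.map_matrix (c : AlgCocycle (glFunctorOf k ι) S S') {A B : Type u} [CommRing A]
    [Algebra k A] [Algebra S A] [IsScalarTower k S A] [CommRing B]
    [Algebra k B] [Algebra S B] [IsScalarTower k S B] (φ : A →ₐ[S] B) (f g : S' →ₐ[S] A) :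
    (c.matrix f g).map φ = c.matrix (φ.comp f) (φ.comp g) :=
  congrArg (fun M : GL ι B => M.1) (c.map_toFun φ f g)

theorem AlgCocycle.mul_matrix (c : AlgCocycle (glFunctorOf k ι) S S') {A : Type u} [CommRing A]
    [Algebra k A] [Algebra S A] [IsScalarTower k S A] (f g h : S' →ₐ[S] A) :
    c.matrix g h * c.matrix f g = c.matrix f h :=
  congrArg (fun M : GL ι A => M.1) (c.mul_toFun f g h)

theorem AlgCocycle.matrix_self (c : AlgCocycle (glFunctorOf k ι) S S') {A : Type u} [CommRing A]
    [Algebra k A] [Algebra S A] [IsScalarTower k S A] (f : S' →ₐ[S] A) : c.matrix f f = 1 :=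
  congrArg (fun M : GL ι A => M.1) (mul_eq_left.1 (c.mul_toFun f f f))

omit [DecidableEq ι] in
theorem comp_mulVec {A B : Type u} [CommRing A] [CommRing B] [Algebra S A] [Algebra S B]
    (φ : A →ₐ[S] B) (M : Matrix ι ι A) (v : ι → A) :
    φ ∘ M.mulVec v = (M.map φ).mulVec (φ ∘ v) :=
  funext fun i => RingHom.map_mulVec φ.toRingHom M v i

/-- The invariance equation, extended linearly in the tensor factor evaluated by `e`. -/
theorem tensorEval_invariants (c : AlgCocycle (glFunctorOf k ι) S S') {A : Type u} [CommRing A]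
    [Algebra k A] [Algebra S A] [IsScalarTower k S A] (e f g : S' →ₐ[S] A)
    (m : S' ⊗[S] invariants c) :
    tensorEval e g ((invariants c).subtype.lTensor S' m) =
      (c.matrix f g).mulVec (tensorEval e f ((invariants c).subtype.lTensor S' m)) := by
  induction m with
  | zero => simp
  | add y z hy hz => simp [hy, hz, Matrix.mulVec_add]
  | tmul a x =>
    have h : g ∘ x = (c.matrix f g).mulVec (f ∘ x) := x.2 A f g
    have h' (φ : S' →ₐ[S] A) : (fun i => e a * φ (x.1 i)) = e a • (φ ∘ x.1) := by
      ext; simp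
    simp only [LinearMap.lTensor_tmul, tensorEval_tmul, Submodule.subtype_apply]
    rw [h', h', h, Matrix.mulVec_smul]

/-- The `S'`-linear extension `S' ⊗ M → S'^ι` of the inclusion of the invariants `M`. -/
def invariantsBaseChange (c : AlgCocycle (glFunctorOf k ι) S S') :
    S' ⊗[S] invariants c →ₗ[S'] (ι → S') :=
  (invariants c).subtype.liftBaseChange S'

theorem invariantsBaseChange_tmul (c : AlgCocycle (glFunctorOf k ι) S S') (a : S')
    (x : invariants c) : invariantsBaseChange c (a ⊗ₜ x) = a • x.1 := by
  simp [invariantsBaseChange]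

theorem tensorEval_self (c : AlgCocycle (glFunctorOf k ι) S S') {A : Type u} [CommRing A]
    [Algebra S A] (f : S' →ₐ[S] A) (m : S' ⊗[S] invariants c) :
    tensorEval f f ((invariants c).subtype.lTensor S' m) = f ∘ invariantsBaseChange c m := by
  induction m with
  | zero => ext; simp
  | add y z hy hz => ext; simp [hy, hz]
  | tmul a x => ext; simp [invariantsBaseChange_tmul]

variable [Algebra k S'] [IsScalarTower k S S']

/-- By flatness `S' ⊗ M` embeds in `S' ⊗ S'^ι`, that is, in `(S' ⊗ S')^ι`. There the image of `m` is
the cocycle matrix applied to `inl ∘ invariantsBaseChange c m`, so it vanishes with the latter. -/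
theorem invariantsBaseChange_injective [Module.Flat S S']
    (c : AlgCocycle (glFunctorOf k ι) S S') : Function.Injective (invariantsBaseChange c) := by
  rw [injective_iff_map_eq_zero]
  intro m hm
  apply Module.Flat.lTensor_preserves_injective_linearMap (M := S') (invariants c).subtype
    Subtype.val_injective
  apply (tensorEval_bijective S S' ι).1
  rw [tensorEval_invariants c _ (inl S S'), tensorEval_self, hm]
  have : inl S S' ∘ (0 : ι → S') = 0 := by ext; simp
  rw [this, Matrix.mulVec_zero, map_zero, map_zero]

/-- The linear map whose kernel is the module of invariants. -/
def descentDefect (c : AlgCocycle (glFunctorOf k ι) S S') :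
    (ι → S') →ₗ[S] (ι → S' ⊗[S] S') :=
  (inr S S').toLinearMap.compLeft ι -
    (Matrix.mulVecLin (c.matrix (inl S S') (inr S S'))).restrictScalars S ∘ₗ
      (inl S S').toLinearMap.compLeft ι

theorem descentDefect_apply (c : AlgCocycle (glFunctorOf k ι) S S') (x : ι → S') :
    descentDefect c x = inr S S' ∘ x -
      (c.matrix (inl S S') (inr S S')).mulVec (inl S S' ∘ x) := rfl

theorem exact_descentDefect (c : AlgCocycle (glFunctorOf k ι) S S') :
    Function.Exact (invariants c).subtype (descentDefect c) := fun x => by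
  rw [descentDefect_apply, sub_eq_zero]
  refine (mem_invariants_iff c x).symm.trans ?_
  simp

/-- After tensoring with `S'`, the defect compares the evaluations of `y` at the three embeddings of
`S'` into the triple tensor product, which is where the cocycle identity can enter. -/
theorem piRight_descentDefect (c : AlgCocycle (glFunctorOf k ι) S S') (y : S' ⊗[S] (ι → S'))
    {j₀ : S' →ₐ[S] S' ⊗[S] (S' ⊗[S] S')} {j : S' ⊗[S] S' →ₐ[S] S' ⊗[S] (S' ⊗[S] S')}
    (hj₀ : j₀ = Algebra.TensorProduct.includeLeft) (hj : j = Algebra.TensorProduct.includeRight) :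
    TensorProduct.piRight S S S' (fun _ : ι => S' ⊗[S] S') ((descentDefect c).lTensor S' y) =
      tensorEval j₀ (j.comp (inr S S')) y -
        (c.matrix (j.comp (inl S S')) (j.comp (inr S S'))).mulVec
          (tensorEval j₀ (j.comp (inl S S')) y) := by
  induction y with
  | zero => simp
  | add y z hy hz =>
    simp only [map_add, hy, hz, Matrix.mulVec_add]
    abel
  | tmul a x =>
    have h (φ : S' →ₐ[S] S' ⊗[S] S') :
        tensorEval j₀ (j.comp φ) (a ⊗ₜ x) = j₀ a • (j ∘ (φ ∘ x)) := by
      ext; simp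
    rw [h, h, Matrix.mulVec_smul, ← c.map_matrix, ← comp_mulVec]
    ext i
    simp [descentDefect_apply, hj₀, hj, TensorProduct.tmul_sub]

/-- For given `w`, the element `y` of `S' ⊗ S'^ι` corresponding to `c(inl, inr) · inl(w)` is killed
by the defect, by the cocycle identity. By flatness it comes from `S' ⊗ M`, and multiplying its two
factors together gives back `w`. -/
theorem invariantsBaseChange_surjective [Module.Flat S S']
    (c : AlgCocycle (glFunctorOf k ι) S S') : Function.Surjective (invariantsBaseChange c) := by
  intro w
  obtain ⟨y, hy⟩ := (tensorEval_bijective S S' ι).2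
    ((c.matrix (inl S S') (inr S S')).mulVec (inl S S' ∘ w))
  let j₀ : S' →ₐ[S] S' ⊗[S] (S' ⊗[S] S') := Algebra.TensorProduct.includeLeft
  let j : S' ⊗[S] S' →ₐ[S] S' ⊗[S] (S' ⊗[S] S') := Algebra.TensorProduct.includeRight
  have key {A : Type u} [CommRing A] [Algebra k A] [Algebra S A] [IsScalarTower k S A]
      (f g : S' →ₐ[S] A) : tensorEval f g y = (c.matrix f g).mulVec (f ∘ w) := by
    let φ : S' ⊗[S] S' →ₐ[S] A := Algebra.TensorProduct.lift f g fun _ _ => Commute.all _ _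
    have hf : φ.comp (inl S S') = f := by ext; simp [φ, inl]
    have hg : φ.comp (inr S S') = g := by ext; simp [φ, inr]
    rw [← hf, ← hg, tensorEval_comp, hy, comp_mulVec, c.map_matrix]
    rfl
  have hy0 : (descentDefect c).lTensor S' y = 0 := by
    apply (TensorProduct.piRight S S S' (fun _ : ι => S' ⊗[S] S')).injective
    rw [piRight_descentDefect c y (j₀ := j₀) (j := j) rfl rfl, key, key, Matrix.mulVec_mulVec,
      c.mul_matrix, sub_self, map_zero]
  obtain ⟨m, rfl⟩ := (Module.Flat.lTensor_exact S' (exact_descentDefect c) y).1 hy0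
  refine ⟨m, ?_⟩
  -- Restriction to the diagonal: there the cocycle is `1`, and evaluation becomes
  -- `invariantsBaseChange`.
  have h := key (AlgHom.id S S') (AlgHom.id S S')
  rw [c.matrix_self, tensorEval_self, Matrix.one_mulVec] at h
  exact h

/-- Faithfully flat descent: the invariants are a form of `S'^ι` over `S`. -/
def invariantsEquiv [Module.Flat S S'] (c : AlgCocycle (glFunctorOf k ι) S S') :
    S' ⊗[S] invariants c ≃ₗ[S'] (ι → S') :=
  LinearEquiv.ofBijective (invariantsBaseChange c)
    ⟨invariantsBaseChange_injective c, invariantsBaseChange_surjective c⟩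

end InvariantsBaseChange

/-! ### Freeness over semi-local rings -/

section Semilocal

variable {S : Type u} [CommRing S] [Finite (MaximalSpectrum S)]

/-- A finite flat module of constant rank over a semi-local ring is free. -/
theorem exists_basis_of_rankAtStalk_eq {M : Type u} [AddCommGroup M] [Module S M]
    [Module.Finite S M] [Module.Flat S M] {n : ℕ}
    (h : ∀ p : PrimeSpectrum S, Module.rankAtStalk M p = n) :
    Nonempty (Module.Basis (Fin n) S M) := by
  refine Module.nonempty_basis_of_flat_of_finrank_eq S M n fun P => ?_
  let := Ideal.Quotient.field P.1
  -- The criterion concerns dimensions over the residue fields; the rank at the only prime of `S ⧸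
  -- P` gives this dimension.
  have h1 := Module.rankAtStalk_baseChange (R := S) (M := M) (⊥ : PrimeSpectrum (S ⧸ P.1))
  rwa [h, Module.rankAtStalk_eq_finrank_of_free] at h1

end Semilocal

/-! ### Cocycles with values in the general linear group -/

section CoboundaryGL

variable {k : Type u} [Field k] {S S' : Type u} [CommRing S] [CommRing S'] [Algebra k S]
  [Algebra k S'] [Algebra S S'] [IsScalarTower k S S'] {ι : Type} [Fintype ι] [DecidableEq ι]

theorem exists_basis_invariants [Finite (MaximalSpectrum S)] [Module.FaithfullyFlat S S']
    (c : AlgCocycle (glFunctorOf k ι) S S') : Nonempty (Module.Basis ι S (invariants c)) := by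
  have e := invariantsEquiv c
  have : Module.Finite S' (S' ⊗[S] invariants c) := Module.Finite.equiv e.symm
  have : Module.Finite S (invariants c) :=
    Module.Finite.of_finite_tensorProduct_of_faithfullyFlat S'
  have : Module.Flat S' (S' ⊗[S] invariants c) := Module.Flat.of_linearEquiv e
  have : Module.Flat S (invariants c) := Module.Flat.of_flat_tensorProduct S _ S'
  obtain ⟨b⟩ := exists_basis_of_rankAtStalk_eq (S := S) (M := invariants c)
    (n := Fintype.card ι) fun p => by
      -- Every prime of `S` lies below one of `S'`, so the rank can be computed after base change,
      -- where the module is `S'^ι`.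
      obtain ⟨q, rfl⟩ := PrimeSpectrum.comap_surjective_of_faithfullyFlat (A := S) (B := S') p
      have : Nontrivial S' := q.nontrivial
      rw [← Module.rankAtStalk_baseChange, Module.rankAtStalk_eq_of_equiv e,
        Module.rankAtStalk_eq_finrank_of_free, Module.finrank_pi]
      rfl
  exact ⟨b.reindex (Fintype.equivFin ι).symm⟩

/-- The vectors `b j` are the images of `1 ⊗ b j` under `invariantsEquiv`, hence a basis of `S'^ι`,
and this is a change-of-basis matrix. -/
theorem isUnit_toMatrix_invariants [Module.FaithfullyFlat S S']
    (c : AlgCocycle (glFunctorOf k ι) S S') (b : Module.Basis ι S (invariants c)) :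
    IsUnit (Matrix.of fun i j => (b j).1 i) := by
  let b' := (b.baseChange S').map (invariantsEquiv c)
  have : (Matrix.of fun i j => (b j).1 i) = (Pi.basisFun S' ι).toMatrix b' := by
    ext i j
    have : b' j = (b j).1 := by
      simp only [b', Module.Basis.map_apply, Module.Basis.baseChange_apply]
      exact (invariantsBaseChange_tmul c 1 (b j)).trans (one_smul _ _)
    simp [Module.Basis.toMatrix_apply, this]
  rw [this]
  exact @isUnit_of_invertible _ _ _ (Module.Basis.invertibleToMatrix (Pi.basisFun S' ι) b')

/-- Over a semi-local ring, every cocycle with values in `GL_ι` is a coboundary. -/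
theorem isCoboundary_gl [Finite (MaximalSpectrum S)] [Module.FaithfullyFlat S S']
    (c : AlgCocycle (glFunctorOf k ι) S S') : c.IsCoboundary := by
  obtain ⟨b⟩ := exists_basis_invariants c
  let h : GL ι S' := (isUnit_toMatrix_invariants c b).unit
  refine ⟨h, fun {A} _ _ _ _ f g => eq_mul_inv_of_mul_eq ?_⟩
  refine Units.ext (Matrix.ext fun i j => ?_)
  -- Invariance of the `j`-th column of `h` is the `j`-th column of `c(f, g) f(h) = g(h)`.
  exact (congrFun ((b j).2 A f g) i).symm

end CoboundaryGL

section Subgroups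

variable {k : Type u} [Field k] {S S' : Type u} [CommRing S] [CommRing S'] [Algebra k S]
  [Algebra k S'] [Algebra S S'] [IsScalarTower k S S'] {ι : Type} [Fintype ι] [DecidableEq ι]

omit [Fintype ι] [DecidableEq ι] in
/-- Descent of elements along a faithfully flat extension. -/
theorem exists_algebraMap_eq [Module.FaithfullyFlat S S'] {a : S'} (h : inl S S' a = inr S S' a) :
    ∃ s : S, algebraMap S S' s = a := by
  refine (Algebra.IsEffective.of_faithfullyFlat S S' a).1 ?_
  rw [Algebra.TensorProduct.includeLeftSubRight_apply, sub_eq_zero]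
  exact h

end Subgroups

/-! ### Symplectic bases over semi-local rings -/

section SymplecticBasis

variable {S : Type u} [CommRing S]

theorem rankAtStalk_prod_self_prod {M : Type u} [AddCommGroup M] [Module S M] [Module.Finite S M]
    [Module.Flat S M] (p : PrimeSpectrum S) :
    Module.rankAtStalk ((S × S) × M) p = 2 + Module.rankAtStalk M p := by
  have := p.nontrivial
  rw [Module.rankAtStalk_prod, Module.rankAtStalk_prod]
  simp

variable {M : Type u} [AddCommGroup M] [Module S M]

theorem isAlt_swap {B : LinearMap.BilinForm S M} (hB : B.IsAlt) (x y : M) : B x y = -B y x := by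
  rw [LinearMap.IsAlt.neg hB]

variable (B : LinearMap.BilinForm S M) (e f : M)

/-- The orthogonal complement of the plane spanned by `e` and `f`. -/
def planeOrthogonal : Submodule S M := LinearMap.ker (B e) ⊓ LinearMap.ker (B f)

variable {B e f}

theorem planeOrthogonal_left (n : planeOrthogonal B e f) : B e n.1 = 0 := n.2.1

theorem planeOrthogonal_right (n : planeOrthogonal B e f) : B f n.1 = 0 := n.2.2

/-- The projection to the orthogonal complement of a hyperbolic plane. -/
def planeProjection (hB : B.IsAlt) (h : B f e = 1) : M →ₗ[S] planeOrthogonal B e f :=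
  LinearMap.codRestrict (planeOrthogonal B e f)
    (LinearMap.id - (B f).smulRight e + (B e).smulRight f) fun x => by
      have hef : B e f = -1 := by rw [isAlt_swap hB, h]
      constructor
      · simp [LinearMap.mem_ker, hB e, hef]
      · simp [LinearMap.mem_ker, hB f, h]

theorem planeProjection_apply (hB : B.IsAlt) (h : B f e = 1) (x : M) :
    (planeProjection hB h x).1 = x - B f x • e + B e x • f := rfl

theorem planeProjection_coe (hB : B.IsAlt) (h : B f e = 1) (n : planeOrthogonal B e f) :
    planeProjection hB h n = n := by
  apply Subtype.ext
  rw [planeProjection_apply, planeOrthogonal_left, planeOrthogonal_right]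
  simp

/-- A module with an alternating form is the direct sum of a hyperbolic plane and its orthogonal
complement. -/
def planeDecomposition (hB : B.IsAlt) (h : B f e = 1) :
    M ≃ₗ[S] (S × S) × planeOrthogonal B e f where
  toLinearMap := LinearMap.prod ((B f).prod (-(B e))) (planeProjection hB h)
  invFun x := x.1.1 • e + x.1.2 • f + x.2.1
  left_inv x := by
    simp only [LinearMap.coe_prod, AddHom.toFun_eq_coe, LinearMap.coe_toAddHom, Function.prod_apply,
      planeProjection_apply, LinearMap.neg_apply, neg_smul]
    abel
  right_inv x := by
    have hef : B e f = -1 := by rw [isAlt_swap hB, h]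
    obtain ⟨⟨a, b⟩, n⟩ := x
    have h1 : B f (a • e + b • f + n.1) = a := by
      simp [hB f, h, planeOrthogonal_right]
    have h2 : B e (a • e + b • f + n.1) = -b := by
      simp [hB e, hef, planeOrthogonal_left]
    refine Prod.ext (Prod.ext h1 ?_) (Subtype.ext ?_)
    · simp [h2]
    · change (planeProjection hB h (a • e + b • f + n.1)).1 = n.1
      rw [planeProjection_apply, h1, h2, neg_smul]
      abel

/-- The restriction of a form to the orthogonal complement of a plane. -/
def planeForm (B : LinearMap.BilinForm S M) (e f : M) :
    LinearMap.BilinForm S (planeOrthogonal B e f) :=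
  B.restrict _

/-- Pairing with a vector of the complement does not see the hyperbolic component, so functionals on
the complement extend by the projection, and the perfectness of `B` passes to it. -/
theorem planeForm_bijective (hB : B.IsAlt) (h : B f e = 1) (hb : Function.Bijective B) :
    Function.Bijective (planeForm B e f) := by
  have key (m : M) (n : planeOrthogonal B e f) :
      B (planeProjection hB h m).1 n.1 = B m n.1 := by
    simp [planeProjection_apply, planeOrthogonal_left, planeOrthogonal_right]
  constructor
  · rw [injective_iff_map_eq_zero]
    intro n hn
    apply Subtype.ext
    apply hb.1
    ext m
    have := LinearMap.congr_fun hn (planeProjection hB h m)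
    have h' : B n.1 (planeProjection hB h m).1 = 0 := this
    rw [isAlt_swap hB, key, ← isAlt_swap hB] at h'
    simpa using h'
  · intro ψ
    obtain ⟨m, hm⟩ := hb.2 (ψ ∘ₗ planeProjection hB h)
    refine ⟨planeProjection hB h m, LinearMap.ext fun n => ?_⟩
    refine (key m n).trans ?_
    rw [hm, LinearMap.comp_apply, planeProjection_coe]

/-- Over a semi-local ring, a perfect alternating form on a finite flat module of constant rank
admits a symplectic family of vectors of maximal size. -/
theorem exists_symplectic_family [Finite (MaximalSpectrum S)] (n : ℕ) :
    ∀ (M : Type u) [AddCommGroup M] [Module S M] [Module.Finite S M] [Module.Flat S M]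
      (B : LinearMap.BilinForm S M), (∀ p : PrimeSpectrum S, Module.rankAtStalk M p = 2 * n) →
      B.IsAlt → Function.Bijective B →
      ∃ v : Fin n ⊕ Fin n → M, ∀ i j, B (v i) (v j) = Matrix.J (Fin n) S i j := by
  induction n with
  | zero => exact fun M _ _ _ _ B _ _ _ => ⟨fun _ => 0, fun i => isEmptyElim i⟩
  | succ n ih =>
    intro M _ _ _ _ B hr hB hb
    obtain ⟨b⟩ := exists_basis_of_rankAtStalk_eq hr
    let e := b ⟨0, by omega⟩
    -- Perfectness supplies `f` dual to the first basis vector `e`. The order `B f e = 1` matches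
    -- the sign in `Matrix.J`, whose upper right block is `-1`.
    obtain ⟨f, hf⟩ := hb.2 (b.coord ⟨0, by omega⟩)
    have h : B f e = 1 := by simp [hf, e]
    have hef : B e f = -1 := by rw [isAlt_swap hB, h]
    let E := planeDecomposition hB h
    have : Module.Finite S (planeOrthogonal B e f) :=
      Module.Finite.of_surjective (planeProjection hB h) fun x => ⟨x.1, planeProjection_coe hB h x⟩
    have : Module.Flat S (planeOrthogonal B e f) :=
      -- The complement is a direct summand, so it is again finite flat of constant rank. It is not
      -- known to be free in advance, hence the form of the induction.
      Module.Flat.of_retract (planeOrthogonal B e f).subtype (planeProjection hB h)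
        (LinearMap.ext (planeProjection_coe hB h))
    obtain ⟨w, hw⟩ := ih (planeOrthogonal B e f) (planeForm B e f) (fun p => by
      have h1 := hr p
      rw [Module.rankAtStalk_eq_of_equiv E, rankAtStalk_prod_self_prod] at h1
      omega) (fun x => hB x.1) (planeForm_bijective hB h hb)
    replace hw : ∀ i j, B (w i).1 (w j).1 = Matrix.J (Fin n) S i j := hw
    have hl (i) : B (w i).1 e = 0 := by rw [isAlt_swap hB, planeOrthogonal_left, neg_zero]
    have hr (i) : B (w i).1 f = 0 := by rw [isAlt_swap hB, planeOrthogonal_right, neg_zero]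
    refine ⟨Sum.elim (Fin.cons e fun i => (w (.inl i)).1) (Fin.cons f fun i => (w (.inr i)).1), ?_⟩
    rintro (i | i) (j | j) <;> induction i using Fin.cases <;> induction j using Fin.cases <;>
      simp [hB e, hB f, h, hef, hw, hl, hr, planeOrthogonal_left, planeOrthogonal_right,
        Matrix.J, Matrix.one_apply, Fin.succ_ne_zero, (Fin.succ_ne_zero _).symm]

end SymplecticBasis

/-- Over a semi-local ring, every invertible alternating matrix is congruent to the matrix of the
standard symplectic form. -/
theorem exists_congruent_J {S : Type u} [CommRing S] [Finite (MaximalSpectrum S)] {n : ℕ}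
    (ω : Matrix (Fin n ⊕ Fin n) (Fin n ⊕ Fin n) S) (h0 : ∀ i, ω i i = 0) (hs : ω.transpose = -ω)
    (hu : IsUnit ω) :
    ∃ P : Matrix (Fin n ⊕ Fin n) (Fin n ⊕ Fin n) S,
      P * ω * P.transpose = Matrix.J (Fin n) S := by
  let B : LinearMap.BilinForm S (Fin n ⊕ Fin n → S) := Matrix.toBilin' ω
  have hB (x y) : B x y = dotProduct x (ω.mulVec y) := Matrix.toBilin'_apply' ω x y
  have hB' (x y) : B x y = dotProduct (ω.vecMul x) y := by rw [hB, Matrix.dotProduct_mulVec]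
  have hd : IsUnit ω.det := (Matrix.isUnit_iff_isUnit_det ω).1 hu
  have hswap (i j) : ω i j = -ω j i := congrFun (congrFun hs j) i
  obtain ⟨v, hv⟩ := exists_symplectic_family n (Fin n ⊕ Fin n → S) B (fun p => by
    have := p.nontrivial
    simp [two_mul]) (fun x => by
      rw [hB]
      simp only [dotProduct, Matrix.mulVec, Finset.mul_sum]
      rw [← Finset.sum_product']
      -- In `B x x` the terms `(i, j)` and `(j, i)` cancel, and the diagonal terms vanish by `h0`;
      -- the separate hypothesis matters in characteristic `2`.
      refine Finset.sum_involution (fun a _ => (a.2, a.1)) (fun a _ => ?_) (fun a _ ha h => ha ?_)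
        (fun a _ => by simp) (fun a _ => rfl)
      · rw [hswap a.1 a.2]
        ring
      · have : a.2 = a.1 := congrArg Prod.fst h
        rw [this, h0]
        ring) ⟨(injective_iff_map_eq_zero B).2 fun x hx => by
          have : ω.vecMul x = 0 := by
            ext i
            have := LinearMap.congr_fun hx (Pi.single i 1)
            rw [hB'] at this
            simpa using this
          rw [← Matrix.vecMul_one x, ← Matrix.mul_nonsing_inv ω hd, ← Matrix.vecMul_vecMul, this,
            Matrix.zero_vecMul], fun ψ => ⟨ω⁻¹.vecMul fun i => ψ (Pi.single i 1), by
              refine LinearMap.pi_ext' fun i => LinearMap.ext_ring ?_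
              simp [hB', Matrix.vecMul_vecMul, Matrix.nonsing_inv_mul ω hd]⟩⟩
  -- With the symplectic vectors as rows of `P`, the entries of `P ω Pᵀ` are the values `B (v i) (v
  -- j)`.
  refine ⟨Matrix.of v, Matrix.ext fun i j => ?_⟩
  rw [← hv i j, hB', Matrix.mul_apply]
  rfl

/-! ### Cocycles with values in the special linear, symplectic and additive groups -/

section CoboundarySubgroups

variable {k : Type u} [Field k] {S S' : Type u} [CommRing S] [CommRing S'] [Algebra k S]
  [Algebra k S'] [Algebra S S'] [IsScalarTower k S S']

theorem exists_matrix_coboundary {ι : Type} [Fintype ι] [DecidableEq ι]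
    [Finite (MaximalSpectrum S)] [Module.FaithfullyFlat S S']
    (c : AlgCocycle (glFunctorOf k ι) S S') :
    ∃ h : GL ι S', ∀ {A : Type u} [CommRing A] [Algebra k A] [Algebra S A] [IsScalarTower k S A]
      (f g : S' →ₐ[S] A), c.matrix f g * h.1.map f = h.1.map g := by
  obtain ⟨h, hh⟩ := isCoboundary_gl c
  exact ⟨h, fun f g => congrArg (fun M : GL ι _ => M.1) (mul_eq_of_eq_mul_inv (hh f g))⟩

variable (k) in
/-- The inclusion of `SL_n` in `GL_n`. -/
def slToGL (n : ℕ) : slFunctor k n ⟶ glFunctorOf k (Fin n) where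
  app R := GrpCat.ofHom Matrix.SpecialLinearGroup.toGL
  naturality R R' f := by
    ext M
    exact Units.ext rfl

/-- Since `c` has determinant `1`, the determinant of a `GL`-trivialization has the same image under
`f` and `g`. Right multiplication by a diagonal matrix built from its inverse therefore preserves
the trivialization while making the determinant `1`. -/
theorem isCoboundary_sl [Finite (MaximalSpectrum S)] [Module.FaithfullyFlat S S'] {n : ℕ}
    (hn : 0 < n) (c : AlgCocycle (slFunctor k n) S S') : c.IsCoboundary := by
  obtain ⟨h, hh⟩ := exists_matrix_coboundary (c.map (slToGL k n))
  let d : S'ˣ := Matrix.GeneralLinearGroup.det h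
  let D : Matrix (Fin n) (Fin n) S' := Matrix.diagonal (Function.update 1 ⟨0, hn⟩ (d⁻¹ : S'ˣ).1)
  have hD : (h.1 * D).det = 1 := by
    have : D.det = (d⁻¹ : S'ˣ).1 := by
      simp [D, Matrix.det_diagonal, Finset.prod_update_of_mem]
    rw [Matrix.det_mul, this]
    exact d.mul_inv
  have hd {A : Type u} [CommRing A] [Algebra k A] [Algebra S A] [IsScalarTower k S A]
      (f g : S' →ₐ[S] A) : D.map f = D.map g := by
    have h1 : Units.map (f : S' →* A) d = Units.map (g : S' →* A) d := by
      apply Units.ext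
      have h2 := congrArg Matrix.det (hh f g)
      have h3 : ((c.map (slToGL k n)).matrix f g).det = 1 :=
        (c.toFun f g : Matrix.SpecialLinearGroup (Fin n) A).2
      have h4 (φ : S' →ₐ[S] A) : (h.1.map φ).det = φ h.1.det := (AlgHom.map_det φ h.1).symm
      rw [Matrix.det_mul, h3, one_mul, h4, h4] at h2
      exact h2
    have h5 : f (d⁻¹ : S'ˣ).1 = g (d⁻¹ : S'ˣ).1 := by
      have := congrArg (fun x : Aˣ => (x⁻¹ : Aˣ).1) h1
      exact this
    simp only [D]
    rw [Matrix.diagonal_map (map_zero f), Matrix.diagonal_map (map_zero g)]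
    congr 1
    ext i
    by_cases hi : i = ⟨0, hn⟩
    · subst hi; simpa using h5
    · simp [hi]
  refine ⟨(⟨h.1 * D, hD⟩ : Matrix.SpecialLinearGroup (Fin n) S'), fun {A} _ _ _ _ f g =>
    eq_mul_inv_of_mul_eq (Subtype.ext ?_)⟩
  change (c.map (slToGL k n)).matrix f g * (h.1 * D).map f = (h.1 * D).map g
  rw [Matrix.map_mul, Matrix.map_mul, ← Matrix.mul_assoc, hh, hd f g]

variable (k) in
/-- The inclusion of `Sp_{2n}` in `GL_{2n}`. -/
def spToGL (n : ℕ) : spFunctor k n ⟶ glFunctorOf k (Fin n ⊕ Fin n) where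
  app R := GrpCat.ofHom (Matrix.symplecticGroup (Fin n) R).subtype.toHomUnits
  naturality R R' f := by
    ext M
    exact Units.ext rfl

/-- A `GL`-trivialization `h` transports the standard form to a form over `S'` which descends to
`S`, because `c` preserves `J`. Over `S` that form is congruent to `J`, and the congruence corrects
`h` to a symplectic matrix. -/
theorem isCoboundary_sp [Finite (MaximalSpectrum S)] [Module.FaithfullyFlat S S'] {n : ℕ}
    (c : AlgCocycle (spFunctor k n) S S') : c.IsCoboundary := by
  obtain ⟨h, hh⟩ := exists_matrix_coboundary (c.map (spToGL k n))
  let C {A : Type u} [CommRing A] [Algebra k A] [Algebra S A] [IsScalarTower k S A]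
      (f g : S' →ₐ[S] A) := (c.map (spToGL k n)).matrix f g
  have hC {A : Type u} [CommRing A] [Algebra k A] [Algebra S A] [IsScalarTower k S A]
      (f g : S' →ₐ[S] A) : C f g * Matrix.J (Fin n) A * (C f g).transpose = Matrix.J (Fin n) A :=
    SymplecticGroup.mem_iff.1 (c.toFun f g : Matrix.symplecticGroup (Fin n) A).2
  let ω : Matrix (Fin n ⊕ Fin n) (Fin n ⊕ Fin n) S' :=
    (h⁻¹).1 * Matrix.J (Fin n) S' * (h⁻¹).1.transpose
  have hω {A : Type u} [CommRing A] [Algebra k A] [Algebra S A] [IsScalarTower k S A]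
      (f g : S' →ₐ[S] A) : ω.map f = ω.map g := by
    have hmap (φ : S' →ₐ[S] A) : ω.map φ = (h⁻¹).1.map φ * Matrix.J (Fin n) A *
        ((h⁻¹).1.map φ).transpose := by
      simp only [ω]
      rw [Matrix.map_mul, Matrix.map_mul, Matrix.map_J, Matrix.transpose_map]
    have hinv (φ : S' →ₐ[S] A) : (h⁻¹).1.map φ * h.1.map φ = 1 := by
      rw [← Matrix.map_mul, ← Units.val_mul, inv_mul_cancel]
      simp
    have hinv' (φ : S' →ₐ[S] A) : h.1.map φ * (h⁻¹).1.map φ = 1 := by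
      rw [← Matrix.map_mul, ← Units.val_mul, mul_inv_cancel]
      simp
    have h1 : (h⁻¹).1.map f = (h⁻¹).1.map g * C f g := by
      calc (h⁻¹).1.map f = (h⁻¹).1.map g * h.1.map g * (h⁻¹).1.map f := by rw [hinv, one_mul]
        _ = (h⁻¹).1.map g * (C f g * h.1.map f) * (h⁻¹).1.map f := by rw [← hh f g]
        _ = (h⁻¹).1.map g * C f g * (h.1.map f * (h⁻¹).1.map f) := by
          simp only [Matrix.mul_assoc]
        _ = _ := by rw [hinv', mul_one]
    rw [hmap f, hmap g, h1, Matrix.transpose_mul]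
    calc _ = (h⁻¹).1.map g * (C f g * Matrix.J (Fin n) A * (C f g).transpose) *
          ((h⁻¹).1.map g).transpose := by simp only [Matrix.mul_assoc]
      _ = _ := by rw [hC]
  have hdesc (i j) : ∃ s : S, algebraMap S S' s = ω i j :=
    exists_algebraMap_eq (congrFun (congrFun (hω (inl S S') (inr S S')) i) j)
  choose Ω hΩ using hdesc
  let Ω' : Matrix (Fin n ⊕ Fin n) (Fin n ⊕ Fin n) S := Matrix.of Ω
  have hΩ' : Ω'.map (algebraMap S S') = ω := Matrix.ext hΩ
  have inj := FaithfulSMul.algebraMap_injective S S'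
  have hs : ω.transpose = -ω := by
    simp only [ω, Matrix.transpose_mul, Matrix.transpose_transpose, Matrix.J_transpose]
    simp [Matrix.mul_assoc]
  -- Skew-symmetry does not imply this in characteristic `2`.
  have h0 (i) : ω i i = 0 := by
    simp [ω, Matrix.mul_apply, Matrix.J, Matrix.fromBlocks, Fintype.sum_sum_type, Matrix.one_apply,
      mul_comm]
  have hu : IsUnit Ω' := by
    rw [Matrix.isUnit_iff_isUnit_det]
    apply isUnit_of_map_unit (algebraMap S S')
    rw [RingHom.map_det, RingHom.mapMatrix_apply, hΩ']
    simp only [ω, Matrix.det_mul, Matrix.det_transpose]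
    have h1 := (Matrix.isUnit_iff_isUnit_det _).1 (h⁻¹).isUnit
    exact (h1.mul (Matrix.isUnit_det_J _ _)).mul h1
  obtain ⟨P, hP⟩ := exists_congruent_J Ω' (fun i => inj (by rw [map_zero, ← h0 i]; exact hΩ i i))
    (Matrix.ext fun i j => inj (by
      have := congrFun (congrFun hs i) j
      rw [← hΩ'] at this
      simpa using this)) hu
  have hPu : IsUnit P.det := by
    have := congrArg Matrix.det hP
    rw [Matrix.det_mul, Matrix.det_mul] at this
    have h2 := Matrix.isUnit_det_J (Fin n) S
    rw [← this, mul_assoc] at h2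
    exact isUnit_of_mul_isUnit_left h2
  have hP' : Ω' = P⁻¹ * Matrix.J (Fin n) S * (P⁻¹).transpose := by
    rw [← hP, Matrix.transpose_nonsing_inv]
    have : IsUnit P.transpose.det := by rwa [Matrix.det_transpose]
    simp only [Matrix.mul_assoc]
    rw [Matrix.mul_nonsing_inv _ this, mul_one, ← Matrix.mul_assoc, Matrix.nonsing_inv_mul _ hPu,
      one_mul]
  -- As `Q` comes from `S`, it has the same image under `f` and `g`, so `h Q` still trivializes `c`.
  let Q := (P⁻¹).map (algebraMap S S')
  have hQ : ω = Q * Matrix.J (Fin n) S' * Q.transpose := by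
    rw [← hΩ', hP', Matrix.map_mul, Matrix.map_mul, Matrix.map_J, Matrix.transpose_map]
  have hb : h.1 * Q ∈ Matrix.symplecticGroup (Fin n) S' := by
    rw [SymplecticGroup.mem_iff, Matrix.transpose_mul]
    have h3 : h.1.transpose = (h.1).transpose := rfl
    calc _ = h.1 * (Q * Matrix.J (Fin n) S' * Q.transpose) * h.1.transpose := by
          simp only [Matrix.mul_assoc]
      _ = (h.1 * (h⁻¹).1) * Matrix.J (Fin n) S' * (h.1 * (h⁻¹).1).transpose := by
          rw [← hQ, Matrix.transpose_mul]
          simp only [ω, Matrix.mul_assoc]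
      _ = _ := by
          rw [← Units.val_mul, mul_inv_cancel]
          simp
  refine ⟨(⟨h.1 * Q, hb⟩ : Matrix.symplecticGroup (Fin n) S'), fun {A} _ _ _ _ f g =>
    eq_mul_inv_of_mul_eq (Subtype.ext ?_)⟩
  change (c.map (spToGL k n)).matrix f g * (h.1 * Q).map f = (h.1 * Q).map g
  rw [Matrix.map_mul, Matrix.map_mul, ← Matrix.mul_assoc, hh]
  congr 1
  ext i j
  simp [Q]

variable (k) in
/-- The embedding of `𝔾_a` in `GL_2` by upper triangular unipotent matrices. -/
def gaToGL : gaFunctor k ⟶ glFunctorOf k (Fin 2) where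
  app R := GrpCat.ofHom (Matrix.GeneralLinearGroup.upperRightHom (R := R)).toMonoidHom
  naturality R R' f := by
    ext a
    refine Units.ext (Matrix.ext fun i j => ?_)
    change (!![1, f.hom (Multiplicative.toAdd a); 0, 1] : Matrix (Fin 2) (Fin 2) R') i j =
      f.hom ((!![1, Multiplicative.toAdd a; 0, 1] : Matrix (Fin 2) (Fin 2) R) i j)
    fin_cases i <;> fin_cases j <;> simp

/-- The value of a cocycle with values in `𝔾_a`, as an element of the ring. -/
def AlgCocycle.value (c : AlgCocycle (gaFunctor k) S S') {A : Type u} [CommRing A]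
    [Algebra k A] [Algebra S A] [IsScalarTower k S A] (f g : S' →ₐ[S] A) : A :=
  Multiplicative.toAdd (c.toFun f g : Multiplicative A)

-- An invariant vector with second coordinate `1` has a first coordinate whose coboundary is `c`;
-- the second equation shows that second coordinates descend to `S`.
omit [Algebra k S'] [IsScalarTower k S S'] in
theorem mem_invariants_ga (c : AlgCocycle (gaFunctor k) S S') {x : Fin 2 → S'}
    (hx : x ∈ invariants (c.map (gaToGL k))) {A : Type u} [CommRing A]
    [Algebra k A] [Algebra S A] [IsScalarTower k S A] (f g : S' →ₐ[S] A) :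
    g (x 0) = f (x 0) + c.value f g * f (x 1) ∧ g (x 1) = f (x 1) := by
  have h : g ∘ x = (!![1, c.value f g; 0, 1] : Matrix (Fin 2) (Fin 2) A).mulVec (f ∘ x) :=
    hx A f g
  constructor
  · simpa [Matrix.mulVec, dotProduct] using congrFun h 0
  · simpa [Matrix.mulVec, dotProduct] using congrFun h 1

/-- Every cocycle with values in `𝔾_a` is a coboundary. -/
theorem isCoboundary_ga [Module.FaithfullyFlat S S'] (c : AlgCocycle (gaFunctor k) S S') :
    c.IsCoboundary := by
  let M := invariants (c.map (gaToGL k))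
  -- The ideal of those `s` in `S` that occur as second coordinates of invariant vectors. The
  -- invariants span `S'^2` over `S'`, so `I` extends to the unit ideal of `S'`, and by faithful
  -- flatness `I` contains `1`.
  let I : Ideal S := (M.map (LinearMap.proj 1)).comap (Algebra.linearMap S S')
  have hI (m : S' ⊗[S] M) :
      invariantsBaseChange (c.map (gaToGL k)) m 1 ∈ I.map (algebraMap S S') := by
    induction m with
    | zero => simp
    | add y z hy hz => rw [map_add]; exact Ideal.add_mem _ hy hz
    | tmul a x =>
      rw [invariantsBaseChange_tmul, Pi.smul_apply, smul_eq_mul]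
      refine Ideal.mul_mem_left _ _ ?_
      obtain ⟨s, hs⟩ :=
        exists_algebraMap_eq (mem_invariants_ga c x.2 (inl S S') (inr S S')).2.symm
      rw [← hs]
      exact Ideal.mem_map_of_mem _ ⟨x.1, x.2, hs.symm⟩
  obtain ⟨m, hm⟩ := invariantsBaseChange_surjective (c.map (gaToGL k)) 1
  have h1 : (1 : S) ∈ I := by
    rw [← Ideal.comap_map_eq_self_of_faithfullyFlat (B := S') I, Ideal.mem_comap, map_one]
    simpa [hm] using hI m
  obtain ⟨x, hx, hx1⟩ := h1
  replace hx1 : x 1 = 1 := by simpa using hx1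
  refine ⟨Multiplicative.ofAdd (x 0), fun {A} _ _ _ _ f g => eq_mul_inv_of_mul_eq ?_⟩
  change Multiplicative.ofAdd (c.value f g + f (x 0)) = Multiplicative.ofAdd (g (x 0))
  rw [(mem_invariants_ga c hx f g).1, hx1, map_one, mul_one, add_comm]

end CoboundarySubgroups

/-! ### Refinement of cocycles and transport along isomorphisms -/

section Refinement

variable {k : Type u} [Field k] {F F' : CommAlgCat.{u} k ⥤ GrpCat.{u}} {S S' : Type u} [CommRing S]
  [CommRing S'] [Algebra k S] [Algebra k S'] [Algebra S S'] [IsScalarTower k S S']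

namespace AlgCocycle

/-- The pullback of a cocycle along a homomorphism `S' → S''`. -/
def refine (c : AlgCocycle F S S') {S'' : Type u} [CommRing S''] [Algebra S S'']
    (φ : S' →ₐ[S] S'') : AlgCocycle F S S'' where
  toFun f g := c.toFun (f.comp φ) (g.comp φ)
  map_toFun ψ f g := c.map_toFun ψ (f.comp φ) (g.comp φ)
  mul_toFun f g h := c.mul_toFun (f.comp φ) (g.comp φ) (h.comp φ)

theorem IsCoboundary.of_map_iso {c : AlgCocycle F S S'} (α : F ≅ F')
    (h : (c.map α.hom).IsCoboundary) : c.IsCoboundary := by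
  obtain ⟨b, hb⟩ := h
  refine ⟨α.inv.app _ b, fun {A} _ _ _ _ f g => ?_⟩
  have h1 (φ : S' →ₐ[S] A) : F.map (CommAlgCat.ofHom (φ.restrictScalars k)) (α.inv.app _ b) =
      α.inv.app _ (F'.map (CommAlgCat.ofHom (φ.restrictScalars k)) b) :=
    (NatTrans.naturality_apply α.inv _ _).symm
  have h2 : α.inv.app _ ((c.map α.hom).toFun f g) = c.toFun f g :=
    ConcreteCategory.congr_hom (α.hom_inv_id_app (CommAlgCat.of k A)) (c.toFun f g)
  rw [h1, h1, ← map_inv, ← map_mul, ← hb, h2]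

end AlgCocycle

end Refinement

/-! ### Functors of points of the affine groups -/

section Category

universe v w

variable {C : Type w} [Category.{v} C] {D : Type*} [Category* D]

/-- If `R : Cᵒᵖ ⥤ D` is a fully faithful right adjoint of `L : D ⥤ Cᵒᵖ`, then `A ↦ L(R(A))` is
isomorphic to the identity. -/
def rightOpCompLeftOpIso {L : D ⥤ Cᵒᵖ} {R : Cᵒᵖ ⥤ D} (adj : L ⊣ R) [R.Full] [R.Faithful] :
    R.rightOp ⋙ L.leftOp ≅ 𝟭 C :=
  (NatIso.ofComponents (fun A => (asIso (adj.counit.app (op A))).unop)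
    (fun f => (congrArg Quiver.Hom.unop (adj.counit.naturality f.op)).symm)).symm

/-- The functor of points of the group object given by a representable functor. -/
def yonedaGrpIso [CartesianMonoidalCategory C] (X : C) (F : Cᵒᵖ ⥤ GrpCat.{v})
    (α : (F ⋙ forget GrpCat).RepresentableBy X) :
    letI := GrpObj.ofRepresentableBy X F α
    yonedaGrp.obj (Grp.mk X) ≅ F :=
  yonedaGrpObjIsoOfRepresentableBy X F α

end Category

section Points

variable {k : Type u} [Field k]

/-- The functor of points of a group scheme on `k`-algebras. -/
def pointsFunctor (G : Grp (Sch k)) : CommAlgCat.{u} k ⥤ GrpCat.{u} :=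
  (algSpec (CommRingCat.of k)).rightOp ⋙ yonedaGrp.obj G

/-- The homomorphism of functors of points induced by a homomorphism of group schemes. -/
def pointsMap {G H : Grp (Sch k)} (f : G ⟶ H) : pointsFunctor G ⟶ pointsFunctor H :=
  Functor.whiskerLeft _ (yonedaGrp.map f)

variable (k) in
/-- The functor `A ↦ Γ(Spec A)` is isomorphic to the identity. -/
def algSpecAlgΓIso : (algSpec (CommRingCat.of k)).rightOp ⋙ (algΓ (CommRingCat.of k)).leftOp ≅
    𝟭 (CommAlgCat.{u} k) :=
  have : (algSpec (CommRingCat.of k)).Full := algSpec.instFull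
  have : (algSpec (CommRingCat.of k)).Faithful := algSpec.instFaithful
  rightOpCompLeftOpIso (algΓAlgSpecAdjunction (CommRingCat.of k))

/-- The functor `A ↦ F(Γ(Spec A))` is isomorphic to `F`. -/
def schFunctorAlgSpecIso (F : CommAlgCat.{u} k ⥤ GrpCat.{u}) :
    (algSpec (CommRingCat.of k)).rightOp ⋙ schFunctor k F ≅ F :=
  (Functor.associator _ _ F).symm ≪≫
    Functor.isoWhiskerRight (algSpecAlgΓIso k) F ≪≫ Functor.leftUnitor F

/-- The functor of points of the affine group scheme representing `F` on all schemes. -/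
def yonedaAffineGroupIso (F : CommAlgCat.{u} k ⥤ GrpCat.{u}) (A : CommAlgCat.{u} k)
    (e : (F ⋙ forget GrpCat).CorepresentableBy A) :
    yonedaGrp.obj (affineGroup k F A e) ≅ schFunctor k F :=
  yonedaGrpIso _ (schFunctor k F) (specRepresentableBy k F A e)

/-- The functor of points of the affine group scheme representing `F` is `F`. -/
def pointsAffineGroupIso (F : CommAlgCat.{u} k ⥤ GrpCat.{u}) (A : CommAlgCat.{u} k)
    (e : (F ⋙ forget GrpCat).CorepresentableBy A) :
    pointsFunctor (affineGroup k F A e) ≅ F :=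
  Functor.isoWhiskerLeft (algSpec (CommRingCat.of k)).rightOp (yonedaAffineGroupIso F A e) ≪≫
    schFunctorAlgSpecIso F

/-- Every cocycle of `S` with values in `G` becomes a coboundary after refinement. -/
def TrivialCocycles (G : Grp (Sch k)) (S : Type u) [CommRing S] [Algebra k S] : Prop :=
  ∀ (S' : Type u) [CommRing S'] [Algebra k S'] [Algebra S S'] [IsScalarTower k S S']
    [Module.FaithfullyFlat S S'] (c : AlgCocycle (pointsFunctor G) S S'),
    ∃ (S'' : Type u) (_ : CommRing S'') (_ : Algebra k S'') (_ : Algebra S S'')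
      (_ : IsScalarTower k S S'') (_ : Module.FaithfullyFlat S S'') (φ : S' →ₐ[S] S''),
      (c.refine φ).IsCoboundary

theorem trivialCocycles_affineGroup (F : CommAlgCat.{u} k ⥤ GrpCat.{u}) (A : CommAlgCat.{u} k)
    (e : (F ⋙ forget GrpCat).CorepresentableBy A) (S : Type u) [CommRing S] [Algebra k S]
    (h : ∀ (S' : Type u) [CommRing S'] [Algebra k S'] [Algebra S S'] [IsScalarTower k S S']
      [Module.FaithfullyFlat S S'] (c : AlgCocycle F S S'), c.IsCoboundary) :
    TrivialCocycles (affineGroup k F A e) S :=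
  fun S' _ _ _ _ _ c => ⟨S', inferInstance, inferInstance, inferInstance, inferInstance,
    inferInstance, AlgHom.id S S',
    (h S' (c.map (pointsAffineGroupIso F A e).hom)).of_map_iso⟩

theorem trivialCocycles_GLn (n : ℕ) (S : Type u) [CommRing S] [Algebra k S]
    [Finite (MaximalSpectrum S)] : TrivialCocycles (GLn k n) S :=
  trivialCocycles_affineGroup _ _ _ S fun _ _ _ _ _ _ c => isCoboundary_gl (ι := Fin n) c

theorem trivialCocycles_SLn {n : ℕ} (hn : 0 < n) (S : Type u) [CommRing S] [Algebra k S]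
    [Finite (MaximalSpectrum S)] : TrivialCocycles (SLn k n) S :=
  trivialCocycles_affineGroup _ _ _ S fun _ _ _ _ _ _ c => isCoboundary_sl hn c

theorem trivialCocycles_Sp2n (n : ℕ) (S : Type u) [CommRing S] [Algebra k S]
    [Finite (MaximalSpectrum S)] : TrivialCocycles (Sp2n k n) S :=
  trivialCocycles_affineGroup _ _ _ S fun _ _ _ _ _ _ c => isCoboundary_sp c

theorem isCoboundary_Ga {S S' : Type u} [CommRing S] [CommRing S'] [Algebra k S] [Algebra k S']
    [Algebra S S'] [IsScalarTower k S S'] [Module.FaithfullyFlat S S']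
    (c : AlgCocycle (pointsFunctor (Ga k)) S S') : c.IsCoboundary :=
  (isCoboundary_ga (c.map (pointsAffineGroupIso (gaFunctor k) _ _).hom)).of_map_iso

end Points

/-! ### Descent of morphisms along faithfully flat algebras -/

section SpecMap

variable {k : Type u} [Field k]

/-- The morphism of spectra over `k` induced by a homomorphism of `k`-algebras. -/
def specMap {A B : Type u} [CommRing A] [Algebra k A] [CommRing B] [Algebra k B] (φ : A →ₐ[k] B) :
    specOver k B ⟶ specOver k A :=
  (algSpec (CommRingCat.of k)).map (CommAlgCat.ofHom φ).op

theorem specMap_comp {A B C : Type u} [CommRing A] [Algebra k A] [CommRing B] [Algebra k B]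
    [CommRing C] [Algebra k C] (φ : A →ₐ[k] B) (ψ : B →ₐ[k] C) :
    specMap (ψ.comp φ) = specMap ψ ≫ specMap φ :=
  (algSpec (CommRingCat.of k)).map_comp (CommAlgCat.ofHom ψ).op (CommAlgCat.ofHom φ).op

theorem exists_specMap_eq {A B : Type u} [CommRing A] [Algebra k A] [CommRing B] [Algebra k B]
    (f : specOver k B ⟶ specOver k A) : ∃ φ : A →ₐ[k] B, specMap φ = f := by
  obtain ⟨g, hg⟩ := (algSpec.instFull (R := CommRingCat.of k)).map_surjective
    (X := op (CommAlgCat.of k B)) (Y := op (CommAlgCat.of k A)) f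
  exact ⟨g.unop.hom, hg⟩

variable {S S' : Type u} [CommRing S] [CommRing S'] [Algebra k S] [Algebra k S'] [Algebra S S']
  [IsScalarTower k S S']

variable (k S S') in
/-- The structure morphism `Spec S' → Spec S` of an `S`-algebra `S'`. -/
def specStr : specOver k S' ⟶ specOver k S := specMap (IsScalarTower.toAlgHom k S S')

/-- Morphisms of `k`-schemes satisfy faithfully flat descent. -/
theorem exists_descent [Module.FaithfullyFlat S S'] {T : Sch k} (t : specOver k S' ⟶ T)
    (ht : specMap ((inl S S').restrictScalars k) ≫ t = specMap ((inr S S').restrictScalars k) ≫ t) :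
    ∃ σ : specOver k S ⟶ T, specStr k S S' ≫ σ = t := by
  let π : Spec (CommRingCat.of S') ⟶ Spec (CommRingCat.of S) :=
    Spec.map (CommRingCat.ofHom (algebraMap S S'))
  obtain ⟨_, _⟩ := (flat_and_surjective_SpecMap_iff (CommRingCat.ofHom (algebraMap S S'))).2
    ((RingHom.faithfullyFlat_algebraMap_iff).2 inferInstance)
  have : EffectiveEpi π := inferInstance
  have hpb := isPullback_SpecMap_of_isPushout _ _ _ _
    (CommRingCat.isPushout_tensorProduct S S' S')
  have hleft : (specMap ((inl S S').restrictScalars k)).left ≫ t.left =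
      (specMap ((inr S S').restrictScalars k)).left ≫ t.left :=
    congrArg (fun f => f.left) ht
  -- Any pair equalized by `π` factors through `Spec (S' ⊗ S')`, so `ht` covers all of them.
  have hd {Z : Scheme.{u}} (g₁ g₂ : Z ⟶ Spec (CommRingCat.of S')) (h : g₁ ≫ π = g₂ ≫ π) :
      g₁ ≫ t.left = g₂ ≫ t.left := by
    rw [← hpb.lift_fst g₁ g₂ h, Category.assoc]
    conv_rhs => rw [← hpb.lift_snd g₁ g₂ h, Category.assoc]
    exact congrArg (fun f => hpb.lift g₁ g₂ h ≫ f) hleft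
  have hfac : π ≫ EffectiveEpi.desc π t.left hd = t.left := EffectiveEpi.fac _ _ _
  refine ⟨Over.homMk (EffectiveEpi.desc π t.left hd) ?_, ?_⟩
  · rw [← cancel_epi π, ← Category.assoc, hfac, Over.w t]
    exact (Over.w (specStr k S S')).symm
  · ext1
    exact hfac

end SpecMap

/-! ### Replacing an fppf covering by a faithfully flat algebra -/

section AffineCover

variable {k : Type u} [Field k]

theorem isZariskiLocalAtSource_of_hasRingHomProperty (P : MorphismProperty Scheme.{u})
    (Q : ∀ {R S : Type u} [CommRing R] [CommRing S], (R →+* S) → Prop) [HasRingHomProperty P Q] :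
    IsZariskiLocalAtSource P :=
  inferInstance

/-- A quasi-compact scheme admits a flat surjection from an affine scheme. -/
theorem exists_affine_flat_surjective (P : Sch k) [CompactSpace P.left] :
    ∃ (A : Type u) (_ : CommRing A) (_ : Algebra k A) (v : specOver k A ⟶ P),
      Flat v.left ∧ Surjective v.left := by
  have := isZariskiLocalAtSource_of_hasRingHomProperty @Flat.{u} RingHom.Flat
  have := (inferInstance : MorphismProperty.IsMultiplicative @Flat.{u}).toContainsIdentities
  obtain ⟨Y, q, _, _, _⟩ := P.left.exists_hom_isAffine_of_isZariskiLocalAtSource @Flat.{u}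
  let g : Spec Γ(Y, ⊤) ⟶ Spec (CommRingCat.of k) := Y.isoSpec.inv ≫ q ≫ P.hom
  let : Algebra k Γ(Y, ⊤) := (Spec.preimage g).hom.toAlgebra
  refine ⟨Γ(Y, ⊤), inferInstance, inferInstance, Over.homMk (Y.isoSpec.inv ≫ q) ?_, ?_, ?_⟩
  · change (Y.isoSpec.inv ≫ q) ≫ P.hom = Spec.map (Spec.preimage g)
    rw [Spec.map_preimage, Category.assoc]
  · change Flat (Y.isoSpec.inv ≫ q)
    infer_instance
  · change Surjective (Y.isoSpec.inv ≫ q)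
    infer_instance

/-- An fppf covering of a quasi-compact scheme is refined by an affine flat covering. -/
theorem IsFppfCover.exists_affine {X' X : Sch k} [CompactSpace X.left] {f : X' ⟶ X}
    (hf : IsFppfCover f) :
    ∃ (A : Type u) (_ : CommRing A) (_ : Algebra k A) (v : specOver k A ⟶ X'),
      Flat (v ≫ f).left ∧ Surjective (v ≫ f).left := by
  have := hf.flat
  have := hf.surjective
  have := hf.locallyOfFinitePresentation
  -- Flat morphisms locally of finite presentation are open, so images of affine opens form an open
  -- cover of the quasi-compact `X`, and finitely many suffice.
  have hopen : IsOpenMap f.left := f.left.isOpenMap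
  obtain ⟨t, ht⟩ := isCompact_univ.elim_finite_subcover
    (fun V : X'.left.affineOpens => f.left '' (V.1 : Set X'.left)) (fun V => hopen _ V.1.2)
    (fun x _ => by
      obtain ⟨y, rfl⟩ := f.left.surjective x
      obtain ⟨V, hV, hy, _⟩ := exists_isAffineOpen_mem_and_subset (TopologicalSpace.Opens.mem_top y)
      exact Set.mem_iUnion.2 ⟨⟨V, hV⟩, y, hy, rfl⟩)
  let U : X'.left.Opens := ⨆ V ∈ t, V.1
  have hU : IsCompact (U : Set X'.left) := by
    simp only [U, TopologicalSpace.Opens.coe_iSup]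
    exact t.isCompact_biUnion fun V _ => V.2.isCompact
  let P : Sch k := Over.mk (U.ι ≫ X'.hom)
  let i : P ⟶ X' := Over.homMk U.ι
  have : CompactSpace P.left := isCompact_iff_compactSpace.1 hU
  obtain ⟨A, _, _, v, hv, hv'⟩ := exists_affine_flat_surjective P
  have hi : Flat i.left := inferInstanceAs (Flat U.ι)
  have hs : Surjective (i ≫ f).left := ⟨fun x => by
    obtain ⟨V, hV, y, hy, rfl⟩ := Set.mem_iUnion₂.1 (ht (Set.mem_univ x))
    have hyU : y ∈ U := by
      simp only [U, TopologicalSpace.Opens.mem_iSup]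
      exact ⟨V, hV, hy⟩
    exact ⟨⟨y, hyU⟩, rfl⟩⟩
  refine ⟨A, inferInstance, inferInstance, v ≫ i, ?_, ?_⟩
  · change Flat ((v.left ≫ i.left) ≫ f.left)
    infer_instance
  · rw [Category.assoc]
    change Surjective (v.left ≫ (i ≫ f).left)
    infer_instance

/-- A flat surjection between affine schemes comes from a faithfully flat algebra. -/
theorem exists_faithfullyFlat {S A : Type u} [CommRing S] [CommRing A] [Algebra k S] [Algebra k A]
    (f : specOver k A ⟶ specOver k S) (hf : Flat f.left) (hs : Surjective f.left) :
    ∃ (_ : Algebra S A) (_ : IsScalarTower k S A), Module.FaithfullyFlat S A ∧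
      f = specStr k S A := by
  obtain ⟨φ, rfl⟩ := exists_specMap_eq f
  let := φ.toRingHom.toAlgebra
  have : IsScalarTower k S A := .of_algebraMap_eq fun x => (φ.commutes x).symm
  exact ⟨_, this, (flat_and_surjective_SpecMap_iff _).1 ⟨hf, hs⟩, rfl⟩

end AffineCover

/-! ### Torsors: simple transitivity, sections and splitting -/

section SimplyTransitive

universe v w

open scoped MonObj

variable {C : Type w} [Category.{v} C] [CartesianMonoidalCategory C] {G : C} [GrpObj G] {T X : C}
  [ModObj G T] {p : T ⟶ X}

theorem smul_comp_of_isPullback (hp : IsPullback (snd G T) γ[G, T] p p) {Z : C} (m : Z ⟶ G)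
    (t : Z ⟶ T) : (m • t) ≫ p = t ≫ p := by
  rw [Hom.smul_def, Category.assoc, ← hp.w, lift_snd_assoc]

theorem exists_smul_eq_of_isPullback (hp : IsPullback (snd G T) γ[G, T] p p) {Z : C}
    {t t' : Z ⟶ T} (h : t ≫ p = t' ≫ p) : ∃ m : Z ⟶ G, m • t = t' := by
  refine ⟨hp.lift t t' h ≫ fst G T, ?_⟩
  rw [Hom.smul_def]
  conv_rhs => rw [← hp.lift_snd t t' h]
  congr 1
  ext
  · simp
  · simp

theorem smul_injective_of_isPullback (hp : IsPullback (snd G T) γ[G, T] p p) {Z : C}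
    {m m' : Z ⟶ G} {t : Z ⟶ T} (h : m • t = m' • t) : m = m' := by
  have : lift m t = lift m' t := hp.hom_ext (by simp) h
  simpa using congrArg (· ≫ fst G T) this

end SimplyTransitive

section Split

open scoped MonObj

variable {k : Type u} [Field k] {G : Sch k} [GrpObj G] {T X : Sch k} [ModObj G T] {p : T ⟶ X}

/-- A torsor with a section is split. -/
theorem isSplitTorsor_of_section (hp : IsPullback (snd G T) γ[G, T] p p) (σ : X ⟶ T)
    (hσ : σ ≫ p = 𝟙 X) : IsSplitTorsor G p := by
  -- Here `m : T ⟶ G` is the difference from the section, `x = m(x) • σ(p(x))`; the pair `(m, p)`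
  -- will be inverse to `(g, y) ↦ g • σ(y)`.
  obtain ⟨m, hm⟩ := exists_smul_eq_of_isPullback hp (t := p ≫ σ) (t' := 𝟙 T) (by simp [hσ])
  let a : G ⊗ X ⟶ T := fst G X • (snd G X ≫ σ)
  have ha : a ≫ p = snd G X := by
    rw [smul_comp_of_isPullback hp, Category.assoc, hσ, Category.comp_id]
  have ham : a ≫ m = fst G X := by
    refine smul_injective_of_isPullback hp (t := snd G X ≫ σ) ?_
    have h := ModObj.comp_smul a m (p ≫ σ)
    rw [hm, Category.comp_id, reassoc_of% ha] at h
    exact h.symm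
  refine ⟨⟨a, lift m p, ?_, ?_⟩, ha, ?_⟩
  · ext
    · rw [Category.assoc, lift_fst, ham, Category.id_comp]
    · rw [Category.assoc, lift_snd, ha, Category.id_comp]
  · rw [ModObj.comp_smul, lift_fst, lift_snd_assoc, hm]
  · let := translation G X
    refine ⟨?_⟩
    have h1 : γ[G, G ⊗ X] ≫ fst G X = fst G (G ⊗ X) * (snd G (G ⊗ X) ≫ fst G X) := by
      change ((α_ G G X).inv ≫ μ[G] ▷ X) ≫ fst G X = _
      rw [Hom.mul_def, Category.assoc, whiskerRight_fst, ← Category.assoc]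
      congr 1
      ext <;> simp
    have h2 : γ[G, G ⊗ X] ≫ snd G X = snd G (G ⊗ X) ≫ snd G X := by
      change ((α_ G G X).inv ≫ μ[G] ▷ X) ≫ snd G X = _
      simp
    have h3 : G ◁ a ≫ γ[G, T] = fst G (G ⊗ X) • (snd G (G ⊗ X) ≫ a) := by
      rw [Hom.smul_def]
      congr 1
    change γ[G, G ⊗ X] ≫ a = G ◁ a ≫ γ[G, T]
    rw [h3, ModObj.comp_smul, ModObj.comp_smul, h1, reassoc_of% h2, mul_smul]

end Split

/-! ### The cocycle of a torsor -/

section Cocycle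

open scoped MonObj

variable {k : Type u} [Field k]

theorem pointsFunctor_map (G : Grp (Sch k)) {A B : Type u} [CommRing A] [Algebra k A] [CommRing B]
    [Algebra k B] (φ : A →ₐ[k] B) (a : specOver k A ⟶ G.X) :
    (pointsFunctor G).map (CommAlgCat.ofHom φ) a = specMap φ ≫ a := rfl

theorem pointsFunctor_mul (G : Grp (Sch k)) {A : Type u} [CommRing A] [Algebra k A]
    (a b : specOver k A ⟶ G.X) :
    @HMul.hMul ((pointsFunctor G).obj (CommAlgCat.of k A)) ((pointsFunctor G).obj (CommAlgCat.of k A))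
      ((pointsFunctor G).obj (CommAlgCat.of k A)) _ a b = a * b := rfl

theorem pointsFunctor_inv (G : Grp (Sch k)) {A : Type u} [CommRing A] [Algebra k A]
    (a : specOver k A ⟶ G.X) :
    @Inv.inv ((pointsFunctor G).obj (CommAlgCat.of k A)) _ a = a⁻¹ := rfl

variable {S S' : Type u} [CommRing S] [CommRing S'] [Algebra k S] [Algebra k S'] [Algebra S S']
  [IsScalarTower k S S'] {G : Grp (Sch k)} {T : Sch k} [ModObj G.X T] {p : T ⟶ specOver k S}

theorem specMap_specStr {A : Type u} [CommRing A] [Algebra k A] [Algebra S A] [IsScalarTower k S A]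
    (f : S' →ₐ[S] A) : specMap (f.restrictScalars k) ≫ specStr k S S' = specStr k S A := by
  rw [specStr, specStr, ← specMap_comp]
  congr 1
  ext x
  exact f.commutes x

theorem exists_smul_specMap_eq (hp : IsPullback (snd G.X T) γ[G.X, T] p p)
    {t : specOver k S' ⟶ T} (ht : t ≫ p = specStr k S S') {A : Type u} [CommRing A] [Algebra k A]
    [Algebra S A] [IsScalarTower k S A] (f g : S' →ₐ[S] A) :
    ∃ m : specOver k A ⟶ G.X,
      m • (specMap (f.restrictScalars k) ≫ t) = specMap (g.restrictScalars k) ≫ t := by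
  refine exists_smul_eq_of_isPullback hp ?_
  rw [Category.assoc, Category.assoc, ht, specMap_specStr, specMap_specStr]

/-- The cocycle of a torsor with respect to a section over `S'`. -/
def torsorCocycle (hp : IsPullback (snd G.X T) γ[G.X, T] p p)
    {t : specOver k S' ⟶ T} (ht : t ≫ p = specStr k S S') :
    AlgCocycle (pointsFunctor G) S S' where
  toFun f g := (exists_smul_specMap_eq hp ht f g).choose
  map_toFun {A B} _ _ _ _ _ _ _ _ φ f g := by
    have h1 := (exists_smul_specMap_eq hp ht f g).choose_spec
    have h2 := (exists_smul_specMap_eq hp ht (φ.comp f) (φ.comp g)).choose_spec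
    have h3 (e : S' →ₐ[S] A) : specMap ((φ.comp e).restrictScalars k) =
      specMap (φ.restrictScalars k) ≫ specMap (e.restrictScalars k) :=
      specMap_comp (e.restrictScalars k) (φ.restrictScalars k)
    rw [pointsFunctor_map]
    refine smul_injective_of_isPullback hp
      (t := specMap ((φ.comp f).restrictScalars k) ≫ t) (Eq.trans ?_ h2.symm)
    rw [h3, h3, Category.assoc, Category.assoc, ← ModObj.comp_smul, h1]
  mul_toFun f g h := by
    have hm := mul_smul (exists_smul_specMap_eq hp ht g h).choose
      (exists_smul_specMap_eq hp ht f g).choose (specMap (f.restrictScalars k) ≫ t)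
    rw [(exists_smul_specMap_eq hp ht f g).choose_spec,
      (exists_smul_specMap_eq hp ht g h).choose_spec] at hm
    exact smul_injective_of_isPullback hp
      (hm.trans (exists_smul_specMap_eq hp ht f h).choose_spec.symm)

theorem torsorCocycle_smul (hp : IsPullback (snd G.X T) γ[G.X, T] p p)
    {t : specOver k S' ⟶ T} (ht : t ≫ p = specStr k S S') {A : Type u} [CommRing A] [Algebra k A]
    [Algebra S A] [IsScalarTower k S A] (f g : S' →ₐ[S] A) :
    @HSMul.hSMul (specOver k A ⟶ G.X) (specOver k A ⟶ T) _ _ ((torsorCocycle hp ht).toFun f g)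
      (specMap (f.restrictScalars k) ≫ t) = specMap (g.restrictScalars k) ≫ t :=
  (exists_smul_specMap_eq hp ht f g).choose_spec

variable (k S S') in
theorem epi_specStr [Module.FaithfullyFlat S S'] : Epi (specStr k S S') := by
  obtain ⟨_, _⟩ := (flat_and_surjective_SpecMap_iff (CommRingCat.ofHom (algebraMap S S'))).2
    ((RingHom.faithfullyFlat_algebraMap_iff).2 inferInstance)
  have : EffectiveEpi (Spec.map (CommRingCat.ofHom (algebraMap S S'))) := inferInstance
  have : Epi (specStr k S S').left :=
    inferInstanceAs (Epi (Spec.map (CommRingCat.ofHom (algebraMap S S'))))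
  exact Over.epi_of_epi_left _

/-- If the cocycle of a torsor is a coboundary, then the torsor is split. -/
theorem isSplitTorsor_of_isCoboundary [Module.FaithfullyFlat S S']
    (hp : IsPullback (snd G.X T) γ[G.X, T] p p) {t : specOver k S' ⟶ T}
    (ht : t ≫ p = specStr k S S') (h : (torsorCocycle hp ht).IsCoboundary) :
    IsSplitTorsor G.X p := by
  obtain ⟨b, hb⟩ := h
  change specOver k S' ⟶ G.X at b
  -- From `g(b) f(b)⁻¹ • f(t) = g(t)` it follows that `b⁻¹ • t` has the same image under `f` and
  -- `g`.
  have key {A : Type u} [CommRing A] [Algebra k A] [Algebra S A] [IsScalarTower k S A]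
      (f g : S' →ₐ[S] A) : specMap (f.restrictScalars k) ≫ (b⁻¹ • t) =
      specMap (g.restrictScalars k) ≫ (b⁻¹ • t) := by
    have h1 := torsorCocycle_smul hp ht f g
    rw [hb f g] at h1
    rw [pointsFunctor_map, pointsFunctor_map, pointsFunctor_inv, pointsFunctor_mul, mul_smul] at h1
    rw [ModObj.comp_smul, ModObj.comp_smul, GrpObj.comp_inv, GrpObj.comp_inv, ← h1, inv_smul_smul]
  obtain ⟨σ, hσ⟩ := exists_descent (k := k) (b⁻¹ • t) (key (inl S S') (inr S S'))
  refine isSplitTorsor_of_section hp σ ?_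
  have := epi_specStr k S S'
  rw [← cancel_epi (specStr k S S'), reassoc_of% hσ, smul_comp_of_isPullback hp, ht,
    Category.comp_id]

theorem hasTrivialTorsorsOverSemilocal_of_trivialCocycles {G : Grp (Sch k)}
    (hG : ∀ (S : Type u) [CommRing S] [Algebra k S] [Finite (MaximalSpectrum S)],
      TrivialCocycles G S) : HasTrivialTorsorsOverSemilocal G := by
  intro S _ _ _ _ T _ p hp
  obtain ⟨X', f, h, hf, hh, _⟩ := hp.locallyTrivial
  have : CompactSpace (specOver k S).left :=
    inferInstanceAs (CompactSpace (Spec (CommRingCat.of S)))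
  obtain ⟨S', _, _, v, hv, hv'⟩ := hf.exists_affine
  obtain ⟨_, _, _, hv''⟩ := exists_faithfullyFlat _ hv hv'
  -- The unit section of the trivialized torsor, restricted to the affine covering.
  let t : specOver k S' ⟶ T := lift 1 v ≫ h
  have ht : t ≫ p = specStr k S S' := by
    rw [← hv'', Category.assoc, hh.w, lift_snd_assoc]
  obtain ⟨S'', _, _, _, _, _, φ, hφ⟩ := hG S S' (torsorCocycle hp.isPullback ht)
  have ht' : (specMap (φ.restrictScalars k) ≫ t) ≫ p = specStr k S S'' := by
    rw [Category.assoc, ht, specMap_specStr]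
  refine isSplitTorsor_of_isCoboundary hp.isPullback ht' ?_
  obtain ⟨b, hb⟩ := hφ
  refine ⟨b, fun {A} _ _ _ _ f g => Eq.trans ?_ (hb f g)⟩
  -- By simple transitivity, the cocycle of the restricted point is the refinement along `φ` of the
  -- cocycle of `t`.
  refine smul_injective_of_isPullback hp.isPullback (Eq.trans (torsorCocycle_smul _ ht' f g) ?_)
  have h3 (e : S'' →ₐ[S] A) : specMap ((e.comp φ).restrictScalars k) =
      specMap (e.restrictScalars k) ≫ specMap (φ.restrictScalars k) :=
    specMap_comp (φ.restrictScalars k) (e.restrictScalars k)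
  have h4 := torsorCocycle_smul hp.isPullback ht (f.comp φ) (g.comp φ)
  rw [h3, h3, Category.assoc, Category.assoc] at h4
  exact h4.symm

end Cocycle

/-! ### Cocycles in extensions and the unipotent tower -/

section Lift

/-- A cocycle whose values lie in the image of an injective homomorphism comes from a cocycle. -/
theorem AlgCocycle.exists_map_toFun_eq {k : Type u} [Field k] {F F' : CommAlgCat.{u} k ⥤ GrpCat.{u}}
    {S S' : Type u} [CommRing S] [CommRing S'] [Algebra k S] [Algebra S S'] (α : F' ⟶ F)
    (hα : ∀ (A : Type u) [CommRing A] [Algebra k A],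
      Function.Injective (α.app (CommAlgCat.of k A))) (c : AlgCocycle F S S')
    (hc : ∀ {A : Type u} [CommRing A] [Algebra k A] [Algebra S A] [IsScalarTower k S A]
      (f g : S' →ₐ[S] A), ∃ x, α.app (CommAlgCat.of k A) x = c.toFun f g) :
    ∃ d : AlgCocycle F' S S', ∀ {A : Type u} [CommRing A] [Algebra k A] [Algebra S A]
      [IsScalarTower k S A] (f g : S' →ₐ[S] A), α.app _ (d.toFun f g) = c.toFun f g :=
  ⟨{ toFun f g := (hc f g).choose
     map_toFun φ f g := by
       apply hα
       rw [(hc _ _).choose_spec, ← c.map_toFun]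
       exact (NatTrans.naturality_apply α _ _).trans
         (congrArg (F.map _) (hc f g).choose_spec)
     mul_toFun f g h := by
       apply hα
       rw [map_mul, (hc _ _).choose_spec, (hc _ _).choose_spec, (hc _ _).choose_spec,
         c.mul_toFun] }, fun f g => (hc f g).choose_spec⟩

end Lift

section Twist

variable {k : Type u} [Field k] {F : CommAlgCat.{u} k ⥤ GrpCat.{u}} {S S' : Type u} [CommRing S]
  [CommRing S'] [Algebra k S] [Algebra k S'] [Algebra S S'] [IsScalarTower k S S']

namespace AlgCocycle

/-- The cocycle cohomologous to `c` obtained from an element of `F(S')`. -/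
def twist (c : AlgCocycle F S S') (b : F.obj (CommAlgCat.of k S')) : AlgCocycle F S S' where
  toFun f g := (F.map (CommAlgCat.ofHom (g.restrictScalars k)) b)⁻¹ * c.toFun f g *
    F.map (CommAlgCat.ofHom (f.restrictScalars k)) b
  map_toFun {A B} _ _ _ _ _ _ _ _ φ f g := by
    have h (e : S' →ₐ[S] A) : F.map (CommAlgCat.ofHom (φ.restrictScalars k))
        (F.map (CommAlgCat.ofHom (e.restrictScalars k)) b) =
        F.map (CommAlgCat.ofHom ((φ.comp e).restrictScalars k)) b :=
      (ConcreteCategory.congr_hom (F.map_comp (CommAlgCat.ofHom (e.restrictScalars k))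
        (CommAlgCat.ofHom (φ.restrictScalars k))) b).symm
    rw [map_mul, map_mul, map_inv, c.map_toFun, h, h]
  mul_toFun f g h := by
    rw [← c.mul_toFun f g h]
    group

end AlgCocycle

end Twist

section Unipotent

open scoped MonObj

variable {k : Type u} [Field k]

theorem IsShortExact.pointsMap_injective {N U Q : Grp (Sch k)} {i : N ⟶ U} {q : U ⟶ Q}
    (h : IsShortExact i q) (A : Type u) [CommRing A] [Algebra k A] :
    Function.Injective ((pointsMap i).app (CommAlgCat.of k A)) := fun _ _ hxy =>
  h.isKernel.hom_ext (W := specOver k A) hxy (toUnit_unique _ _)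

theorem IsShortExact.exists_pointsMap_eq {N U Q : Grp (Sch k)} {i : N ⟶ U} {q : U ⟶ Q}
    (h : IsShortExact i q) {A : Type u} [CommRing A] [Algebra k A]
    (x : (pointsFunctor U).obj (CommAlgCat.of k A)) (hx : (pointsMap q).app _ x = 1) :
    ∃ y, (pointsMap i).app (CommAlgCat.of k A) y = x :=
  ⟨h.isKernel.lift (W := specOver k A) x (toUnit _) hx, h.isKernel.lift_fst _ _ _⟩

/-- Needed so that points of the additive group lift to `U` over a single affine faithfully flat
cover. -/
theorem quasiCompact_Ga_left {U : Grp (Sch k)} (q : U ⟶ Ga k) (hU : QuasiCompact U.X.hom) :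
    QuasiCompact q.hom.hom.left := by
  have : IsAffine (Ga k).X.left := inferInstanceAs (IsAffine (Spec _))
  have hw := Over.w q.hom.hom
  rw [← hw] at hU
  have : QuasiSeparated (Ga k).X.hom := inferInstance
  exact QuasiCompact.of_comp _ (Ga k).X.hom

/-- The kernel inclusion is a base change of the unit section, a morphism of affine schemes. This
carries quasi-compactness down the tower. -/
theorem IsShortExact.quasiCompact {N U : Grp (Sch k)} {i : N ⟶ U} {q : U ⟶ Ga k}
    (h : IsShortExact i q) (hU : QuasiCompact U.X.hom) : QuasiCompact N.X.hom := by
  have : IsAffine (Ga k).X.left := inferInstanceAs (IsAffine (Spec _))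
  have : IsAffine (𝟙_ (Sch k)).left := inferInstanceAs (IsAffine (Spec _))
  have hη : QuasiCompact (η[(Ga k).X]).left := inferInstance
  have hi : QuasiCompact i.hom.hom.left :=
    MorphismProperty.of_isPullback (h.isKernel.map (Over.forget _)).flip hη
  rw [← Over.w i.hom.hom]
  infer_instance

/-- Points of `Q` lift along a quasi-compact faithfully flat homomorphism `U → Q` after a
faithfully flat extension. -/
theorem exists_lift_of_flat {X Y : Sch k} (q : X ⟶ Y) [Flat q.left] [Surjective q.left]
    [QuasiCompact q.left] {A : Type u} [CommRing A] [Algebra k A] (a : specOver k A ⟶ Y) :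
    ∃ (B : Type u) (_ : CommRing B) (_ : Algebra k B) (_ : Algebra A B) (_ : IsScalarTower k A B)
      (_ : Module.FaithfullyFlat A B) (x : specOver k B ⟶ X), x ≫ q = specStr k A B ≫ a := by
  have hp : IsPullback (Limits.pullback.fst q a).left (Limits.pullback.snd q a).left
      q.left a.left := (IsPullback.of_hasPullback q a).map (Over.forget _)
  have hqc : QuasiCompact (Limits.pullback.snd q a).left :=
    MorphismProperty.of_isPullback hp inferInstance
  have hfl : Flat (Limits.pullback.snd q a).left :=
    MorphismProperty.of_isPullback hp inferInstance
  have hsu : Surjective (Limits.pullback.snd q a).left :=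
    MorphismProperty.of_isPullback hp inferInstance
  have : CompactSpace (specOver k A).left :=
    inferInstanceAs (CompactSpace (Spec (CommRingCat.of A)))
  have : CompactSpace (Limits.pullback q a).left :=
    QuasiCompact.compactSpace_of_compactSpace (Limits.pullback.snd q a).left
  obtain ⟨B, _, _, v, _, _⟩ := exists_affine_flat_surjective (Limits.pullback q a)
  obtain ⟨_, _, _, hv⟩ := exists_faithfullyFlat (v ≫ Limits.pullback.snd q a)
    (inferInstanceAs (Flat (v.left ≫ (Limits.pullback.snd q a).left)))
    (inferInstanceAs (Surjective (v.left ≫ (Limits.pullback.snd q a).left)))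
  refine ⟨B, inferInstance, inferInstance, inferInstance, inferInstance, inferInstance,
    v ≫ Limits.pullback.fst q a, ?_⟩
  rw [← hv, Category.assoc, Category.assoc, Limits.pullback.condition]

theorem trivialCocycles_of_isIso {U : Grp (Sch k)} (h : IsIso (toUnit U.X)) (S : Type u)
    [CommRing S] [Algebra k S] : TrivialCocycles U S :=
  fun S' _ _ _ _ _ _ => ⟨S', inferInstance, inferInstance, inferInstance, inferInstance,
    inferInstance, AlgHom.id S S', 1, fun {A} _ _ _ _ _ _ =>
      (cancel_mono (Z := specOver k A) (toUnit U.X)).1 (toUnit_unique _ _)⟩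

/-- Exactness in the middle of `H¹(N) → H¹(U) → H¹(𝔾_a)`, where the last term vanishes: a lift `x`
of the element trivializing `q(c)` twists `c` into a cocycle of `N`. -/
theorem IsShortExact.trivialCocycles {N U : Grp (Sch k)} {i : N ⟶ U} {q : U ⟶ Ga k}
    (h : IsShortExact i q) (hU : QuasiCompact U.X.hom) {S : Type u} [CommRing S] [Algebra k S]
    (hN : TrivialCocycles N S) : TrivialCocycles U S := by
  intro S' _ _ _ _ _ c
  obtain ⟨a, ha⟩ := isCoboundary_Ga (c.map (pointsMap q))
  have := quasiCompact_Ga_left q hU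
  have := h.flat
  have := h.surjective
  obtain ⟨S'', _, _, _, _, _, x, hx⟩ := exists_lift_of_flat q.hom.hom (A := S') a
  let : Algebra S S'' := ((algebraMap S' S'').comp (algebraMap S S')).toAlgebra
  have : IsScalarTower S S' S'' := .of_algebraMap_eq fun _ => rfl
  have : IsScalarTower k S S'' := .of_algebraMap_eq fun r => by
    rw [IsScalarTower.algebraMap_apply S S' S'', ← IsScalarTower.algebraMap_apply k S S',
      ← IsScalarTower.algebraMap_apply k S' S'']
  have : Module.FaithfullyFlat S S'' := Module.FaithfullyFlat.trans S S' S''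
  let φ : S' →ₐ[S] S'' := IsScalarTower.toAlgHom S S' S''
  let x' : (pointsFunctor U).obj (CommAlgCat.of k S'') := x
  have hx' {A : Type u} [CommRing A] [Algebra k A] [Algebra S A] [IsScalarTower k S A]
      (f : S'' →ₐ[S] A) : (pointsMap q).app _
        ((pointsFunctor U).map (CommAlgCat.ofHom (f.restrictScalars k)) x') =
        (pointsFunctor (Ga k)).map (CommAlgCat.ofHom ((f.comp φ).restrictScalars k)) a := by
    refine (NatTrans.naturality_apply (pointsMap q) _ _).trans ?_
    refine Eq.trans ?_ (ConcreteCategory.congr_hom ((pointsFunctor (Ga k)).map_comp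
      (CommAlgCat.ofHom (φ.restrictScalars k)) (CommAlgCat.ofHom (f.restrictScalars k))) a).symm
    exact congrArg ((pointsFunctor (Ga k)).map (CommAlgCat.ofHom (f.restrictScalars k))) hx
  obtain ⟨d, hd⟩ := ((c.refine φ).twist x').exists_map_toFun_eq (pointsMap i)
    h.pointsMap_injective (fun f g => h.exists_pointsMap_eq _ (by
      have := ha (f.comp φ) (g.comp φ)
      change (pointsMap q).app _ (c.toFun (f.comp φ) (g.comp φ)) = _ at this
      change (pointsMap q).app _ (_⁻¹ * c.toFun (f.comp φ) (g.comp φ) * _) = 1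
      rw [map_mul, map_mul, map_inv, hx', hx', this]
      group))
  obtain ⟨R, _, _, _, _, _, ψ, y, hy⟩ := hN S'' d
  -- From `g(x)⁻¹ c(f, g) f(x) = i(g(y) f(y)⁻¹)` one reads off that `x · i(y)` trivializes `c`.
  refine ⟨R, inferInstance, inferInstance, inferInstance, inferInstance, inferInstance,
    ψ.comp φ, (pointsFunctor U).map (CommAlgCat.ofHom (ψ.restrictScalars k)) x' *
      (pointsMap i).app _ y, fun {A} _ _ _ _ f g => ?_⟩
  have h1 (e : R →ₐ[S] A) : (pointsFunctor U).map (CommAlgCat.ofHom (e.restrictScalars k))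
      ((pointsFunctor U).map (CommAlgCat.ofHom (ψ.restrictScalars k)) x' *
        (pointsMap i).app _ y) =
      (pointsFunctor U).map (CommAlgCat.ofHom ((e.comp ψ).restrictScalars k)) x' *
        (pointsMap i).app _ ((pointsFunctor N).map (CommAlgCat.ofHom (e.restrictScalars k)) y) := by
    rw [map_mul]
    congr 1
    exact (ConcreteCategory.congr_hom ((pointsFunctor U).map_comp
      (CommAlgCat.ofHom (ψ.restrictScalars k)) (CommAlgCat.ofHom (e.restrictScalars k))) x').symm
  have h2 := hd (f.comp ψ) (g.comp ψ)
  have h3 : d.toFun (f.comp ψ) (g.comp ψ) = _ := hy f g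
  rw [h3, map_mul, map_inv] at h2
  change _ = (_)⁻¹ * c.toFun (f.comp (ψ.comp φ)) (g.comp (ψ.comp φ)) * _ at h2
  change c.toFun (f.comp (ψ.comp φ)) (g.comp (ψ.comp φ)) = _
  rw [h1, h1, mul_inv_rev, mul_assoc, ← mul_assoc (((pointsMap i).app _ _)), h2]
  rw [mul_inv_cancel_right, mul_inv_cancel_left]

theorem HasGaTower.trivialCocycles {U : Grp (Sch k)} (h : HasGaTower U)
    (hU : QuasiCompact U.X.hom) (S : Type u) [CommRing S] [Algebra k S] : TrivialCocycles U S := by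
  induction h with
  | trivial U h => exact trivialCocycles_of_isIso h S
  | step N U i q h _ ih => exact h.trivialCocycles hU (ih (h.quasiCompact hU))

end Unipotent

end SpecialGroups

end

theorem lemma3p2 (k : Type u) [Field k] :
    (∀ n : ℕ, 0 < n → SpecialGroups.HasTrivialTorsorsOverSemilocal (SpecialGroups.GLn k n)) ∧
    (∀ n : ℕ, 0 < n → SpecialGroups.HasTrivialTorsorsOverSemilocal (SpecialGroups.SLn k n)) ∧
    (∀ n : ℕ, 0 < n → SpecialGroups.HasTrivialTorsorsOverSemilocal (SpecialGroups.Sp2n k n)) ∧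
    (∀ U : Grp (SpecialGroups.Sch k), SpecialGroups.IsSplitUnipotent U →
      SpecialGroups.HasTrivialTorsorsOverSemilocal U) := by
  open SpecialGroups in
  exact ⟨fun n _ => hasTrivialTorsorsOverSemilocal_of_trivialCocycles
      fun S _ _ _ => trivialCocycles_GLn n S,
    fun n hn => hasTrivialTorsorsOverSemilocal_of_trivialCocycles
      fun S _ _ _ => trivialCocycles_SLn hn S,
    fun n _ => hasTrivialTorsorsOverSemilocal_of_trivialCocycles
      fun S _ _ _ => trivialCocycles_Sp2n n S,
    fun U hU => hasTrivialTorsorsOverSemilocal_of_trivialCocycles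
      fun S _ _ _ => hU.tower.trivialCocycles hU.quasiCompact S⟩
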